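/- Let $d\ge 2$, $J>0$ and $\alpha>d$ be fixed, and let $|\cdot|$ be the $\ell^1$-norm on $\mathbb{Z}^d$. For $h^*>0$ and $\delta>0$ consider on $\Omega=\{-1,+1\}^{\mathbb{Z}^d}$ the long-range Ising model with couplings $J_{xy}=J|x-y|^{-\alpha}$ for $x\ne y$, $J_{xx}=0$, and field $h_x=h^*|x|^{-\delta}$ for $x\neq 0$, $h_0=h^*$. For finite $\Lambda\subset\mathbb{Z}^d$ and $\omega\in\Omega$ put $$H^\omega_\Lambda(\sigma)=-\sum_{\{x,y\}\subset\Lambda}J_{xy}\sigma_x\sigma_y-\sum_{x\in\Lambda,\,y\notin\Lambda}J_{xy}\sigma_x\omega_y-\sum_{x\in\Lambda}h_x\sigma_x ,$$ and, for $\beta>0$, let $\mu^\omega_{\beta,\Lambda}$ be the probability measure on $\Omega$ that gives mass proportional to $e^{-\beta H^\omega_\Lambda(\sigma)}$ to each $\sigma$ with $\sigma=\omega$ off $\Lambda$, and no mass to other configurations. Let $\mathcal{G}_\beta$ be the weak-* closed convex hull of all weak-* limits of sequences $\mu^\omega_{\beta,\Lambda_n}$, where $\omega\in\Omega$ and $(\Lambda_n)$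 is a sequence of finite sets such that every finite subset of $\mathbb{Z}^d$ is contained in $\Lambda_n$ for all large $n$. The model undergoes a phase transition at $\beta$ if $|\mathcal{G}_\beta|>1$. **Theorem.** There are $\beta_c>0$ and $h_0>0$, depending only on $\alpha$, $d$ and the coupling strength $J$, such that for every $\beta>\beta_c$, $\delta>0$ and $h^*>0$ the model undergoes a phase transition at $\beta$ in each of the following cases: - $d<\alpha<d+1$ and $\delta>\alpha-d$; - $d<\alpha<d+1$, $\delta=\alpha-d$ and $h^*\le h_0$; - $\alpha\ge d+1$ and $\delta>1$; - $\alpha\ge d+1$, $\delta=1$ and $h^*\le h_0$. -/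

import Mathlib

open MeasureTheory Filter Topology
open scoped NNReal

namespace LongRangeIsing

/-- The lattice `ℤ^d`. -/
abbrev Site (d : ℕ) : Type := Fin d → ℤ

/-- The configuration space `{-1,+1}^(ℤ^d)`, with the product topology and the product
σ-algebra; the unit group `ℤˣ` consists of exactly `1` and `-1`. -/
abbrev Config (d : ℕ) : Type := Site d → ℤˣ

/-- The σ-algebra on the two-point discrete space `ℤˣ` consists of all subsets, so it is the
Borel σ-algebra. -/
instance instBorelSpaceSpin : BorelSpace ℤˣ := by
  constructor
  rw [borel_eq_top_of_discrete, eq_top_iff]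
  intro s _
  exact ⟨Units.val '' s, trivial, Set.preimage_image_eq s Units.val_injective⟩

/-- The value of a spin as a real number. -/
def spin (s : ℤˣ) : ℝ := ((s : ℤ) : ℝ)

/-- The `ℓ¹`-norm on `ℤ^d`. -/
def l1 {d : ℕ} (x : Site d) : ℝ := ∑ i, |(x i : ℝ)|

/-- The coupling `J_{xy} = J |x-y|^{-α}` for `x ≠ y`, and `J_{xx} = 0`. -/
noncomputable def coupling {d : ℕ} (J α : ℝ) (x y : Site d) : ℝ :=
  if x = y then 0 else J / l1 (x - y) ^ α

/-- The field `h_x = h* |x|^{-δ}` for `x ≠ 0`, and `h_0 = h*`. -/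
noncomputable def decayingField {d : ℕ} (hs δ : ℝ) (x : Site d) : ℝ :=
  if x = 0 then hs else hs / l1 x ^ δ

/-- The configuration equal to `τ` on `Λ` and to `ω` off `Λ`. -/
def glue {d : ℕ} (Λ : Finset (Site d)) (ω : Config d) (τ : Λ → ℤˣ) : Config d :=
  fun x => if hx : x ∈ Λ then τ ⟨x, hx⟩ else ω x

/-- The Hamiltonian in the finite volume `Λ` with boundary condition `ω` and field `h`.
Each unordered pair `{x,y} ⊆ Λ` occurs twice in the first double sum, hence the factor `1/2`
(the diagonal terms vanish). -/
noncomputable def hamiltonian {d : ℕ} (J α : ℝ) (h : Site d → ℝ) (Λ : Finset (Site d))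
    (ω σ : Config d) : ℝ :=
  -((1 / 2 : ℝ) * ∑ x ∈ Λ, ∑ y ∈ Λ, coupling J α x y * spin (σ x) * spin (σ y))
    - (∑ x ∈ Λ, ∑' y : {y : Site d // y ∉ Λ}, coupling J α x y * spin (σ x) * spin (ω y))
    - ∑ x ∈ Λ, h x * spin (σ x)

/-- The Boltzmann weight of `τ ∈ {-1,+1}^Λ`, extended by `ω` off `Λ`. -/
noncomputable def weight {d : ℕ} (J α : ℝ) (h : Site d → ℝ) (β : ℝ) (Λ : Finset (Site d))
    (ω : Config d) (τ : Λ → ℤˣ) : ℝ :=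
  Real.exp (-β * hamiltonian J α h Λ ω (glue Λ ω τ))

/-- The partition function. -/
noncomputable def partitionFunction {d : ℕ} (J α : ℝ) (h : Site d → ℝ) (β : ℝ)
    (Λ : Finset (Site d)) (ω : Config d) : ℝ :=
  ∑ τ : Λ → ℤˣ, weight J α h β Λ ω τ

/-- The finite-volume Gibbs measure as a measure on the whole configuration space: it gives mass
`exp (-β H) / Z` to each configuration that agrees with `ω` off `Λ`. -/
noncomputable def finiteVolumeMeasure {d : ℕ} (J α : ℝ) (h : Site d → ℝ) (β : ℝ)
    (Λ : Finset (Site d)) (ω : Config d) : Measure (Config d) :=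
  ∑ τ : Λ → ℤˣ,
    ENNReal.ofReal (weight J α h β Λ ω τ / partitionFunction J α h β Λ ω) •
      Measure.dirac (glue Λ ω τ)

theorem partitionFunction_pos {d : ℕ} (J α : ℝ) (h : Site d → ℝ) (β : ℝ)
    (Λ : Finset (Site d)) (ω : Config d) : 0 < partitionFunction J α h β Λ ω :=
  Finset.sum_pos (fun _ _ => Real.exp_pos _) Finset.univ_nonempty

theorem isProbabilityMeasure_finiteVolumeMeasure {d : ℕ} (J α : ℝ) (h : Site d → ℝ) (β : ℝ)
    (Λ : Finset (Site d)) (ω : Config d) :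
    IsProbabilityMeasure (finiteVolumeMeasure J α h β Λ ω) := by
  have hZ := partitionFunction_pos J α h β Λ ω
  constructor
  simp only [finiteVolumeMeasure, Measure.finsetSum_apply, Measure.smul_apply, measure_univ,
    smul_eq_mul, mul_one]
  have hw : ∀ τ ∈ (Finset.univ : Finset (Λ → ℤˣ)),
      0 ≤ weight J α h β Λ ω τ / partitionFunction J α h β Λ ω :=
    fun _ _ => div_nonneg (Real.exp_pos _).le hZ.le
  rw [← ENNReal.ofReal_sum_of_nonneg hw, ← Finset.sum_div]
  change ENNReal.ofReal (partitionFunction J α h β Λ ω / _) = 1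
  rw [div_self hZ.ne', ENNReal.ofReal_one]

/-- The finite-volume Gibbs measure as a probability measure. -/
noncomputable def finiteVolumeGibbs {d : ℕ} (J α : ℝ) (h : Site d → ℝ) (β : ℝ)
    (Λ : Finset (Site d)) (ω : Config d) : ProbabilityMeasure (Config d) :=
  ⟨finiteVolumeMeasure J α h β Λ ω, isProbabilityMeasure_finiteVolumeMeasure J α h β Λ ω⟩

/-- A sequence of finite sets invades the lattice if every finite set is eventually contained
in its members. -/
def Invades {d : ℕ} (Λ : ℕ → Finset (Site d)) : Prop :=
  ∀ Δ : Finset (Site d), ∃ N, ∀ n, N ≤ n → Δ ⊆ Λ n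

/-- All weak-* limits of finite-volume Gibbs measures, over all boundary conditions and all
sequences of volumes that invade the lattice. -/
def thermodynamicLimits {d : ℕ} (J α : ℝ) (h : Site d → ℝ) (β : ℝ) :
    Set (ProbabilityMeasure (Config d)) :=
  {μ | ∃ (ω : Config d) (Λ : ℕ → Finset (Site d)), Invades Λ ∧
    Tendsto (fun n => finiteVolumeGibbs J α h β (Λ n) ω) atTop (𝓝 μ)}

/-- The set of Gibbs measures: the weak-* closed convex hull of the thermodynamic limits. -/
def gibbsMeasures {d : ℕ} (J α : ℝ) (h : Site d → ℝ) (β : ℝ) :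
    Set (ProbabilityMeasure (Config d)) :=
  closure {μ | (μ : Measure (Config d)) ∈
    convexHull ℝ≥0 ((fun ν : ProbabilityMeasure (Config d) => (ν : Measure (Config d))) ''
      thermodynamicLimits J α h β)}

/-- Phase transition: there is more than one Gibbs measure. -/
def PhaseTransition {d : ℕ} (J α : ℝ) (h : Site d → ℝ) (β : ℝ) : Prop :=
  1 < (gibbsMeasures J α h β).encard

end LongRangeIsing

/-! A Peierls argument whose contours are kept so far apart that the long-range coupling between
them is a small correction. Fix a constant boundary condition `b` on a cube and let `P` be the set
of sites with spin `≠ b`. The edges of `bdry P` are grouped into clusters such that clusters of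
sizes `k` and `l` are more than `R * min k l ^ a` apart (`exists_clusters`). This exceeds the
diameter of a plaquette, so each cluster is itself the boundary of a finite set `A`, and the
indicator of `P` is the sum mod 2 of the indicators of these sets (`exists_isContourFamily`).

Energy. Let cut(A) be the total coupling between `A` and its complement; it is at least `J` times
the perimeter. Reversing the spins in `A` gains 2 cut(A), minus four times the coupling of the pairs
across the boundary with equal spins, minus a field term. By parity, a pair with equal spins is
separated by another contour. If that contour is no longer than the boundary of `A`, it is so remote
and sparse that its sites can be spread over many translates at the price of a factor `2 ^ α`; if it
is longer, the two sites are far apart and the tail of the coupling is small. Together such pairs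
carry at most cut(A)/8 (`exists_cross_le`).

Field. Hardy inequalities bound the sum of `|x|^{-s}` over `A` by a constant times cut(A), for `s =
1` and, if `α < d + 1`, for `s = α - d` (`exists_sum_decay_le`). For `δ = s` a small `h*` suffices.
For `δ > s` the field is a small multiple of `|x|^{-s}` off a finite set, and one observes a spin
`x₀` far from that set: a contour around `x₀` that encloses part of the set is so long that it pays
for the whole field there.

Entropy. A cluster of `n` edges is traced by a closed walk whose weight, a product of step weights
`η / (1 + |v|)^(d+1)`, is at least `ρ ^ n` (`exists_clusterWeight`). All walks from one point have
total weight at most 2, so contours around `x₀` are summable against `q ^ n` for small `q`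
(`sum_pow_card_bdry_le`). At low temperature the spin at `x₀` thus disagrees with `b` with
probability at most 1/4, uniformly in the cube, and the limits for `b = 1` and `b = -1` differ. -/

namespace LongRangeIsing

open scoped ENNReal

/-! ### The lattice, its edges and edge boundaries -/

/-- The `ℓ¹`-norm as a natural number. -/
def nrm {d : ℕ} (x : Site d) : ℕ := ∑ i, (x i).natAbs

theorem l1_eq_nrm {d : ℕ} (x : Site d) : l1 x = (nrm x : ℝ) := by
  simp [l1, nrm, Nat.cast_natAbs]

theorem nrm_add_le {d : ℕ} (x y : Site d) : nrm (x + y) ≤ nrm x + nrm y := by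
  unfold nrm
  rw [← Finset.sum_add_distrib]
  exact Finset.sum_le_sum fun i _ => Int.natAbs_add_le _ _

@[simp] theorem nrm_neg {d : ℕ} (x : Site d) : nrm (-x) = nrm x := by simp [nrm]

theorem nrm_sub_comm {d : ℕ} (x y : Site d) : nrm (x - y) = nrm (y - x) := by
  rw [← nrm_neg, neg_sub]

theorem nrm_sub_le {d : ℕ} (x y z : Site d) : nrm (x - z) ≤ nrm (x - y) + nrm (y - z) := by
  simpa using nrm_add_le (x - y) (y - z)

@[simp] theorem nrm_zero {d : ℕ} : nrm (0 : Site d) = 0 := by simp [nrm]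

theorem nrm_eq_zero {d : ℕ} {x : Site d} : nrm x = 0 ↔ x = 0 := by
  simp [nrm, funext_iff]

theorem nrm_pos {d : ℕ} {x : Site d} (hx : x ≠ 0) : 0 < nrm x :=
  Nat.pos_of_ne_zero fun h => hx (nrm_eq_zero.1 h)

/-- The `i`-th unit vector. -/
def unit {d : ℕ} (i : Fin d) : Site d := Pi.single i 1

@[simp] theorem unit_self {d : ℕ} (i : Fin d) : unit i i = 1 := by simp [unit]

theorem unit_ne {d : ℕ} {i j : Fin d} (h : j ≠ i) : unit i j = 0 := by simp [unit, h]

theorem nrm_smul_unit {d : ℕ} (k : ℤ) (i : Fin d) : nrm (k • unit i) = k.natAbs := by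
  unfold nrm
  rw [Finset.sum_eq_single i]
  · simp
  · intro j _ hj
    simp [unit_ne hj]
  · simp

@[simp] theorem nrm_unit {d : ℕ} (i : Fin d) : nrm (unit i) = 1 := by
  simpa using nrm_smul_unit 1 i

/-- Nearest-neighbour edges: `(x, i)` is the edge between `x` and `x + unit i`. -/
abbrev Edge (d : ℕ) : Type := Site d × Fin d

/-- The distance between the base points of two edges. -/
def edist {d : ℕ} (e f : Edge d) : ℕ := nrm (e.1 - f.1)

theorem edist_comm {d : ℕ} (e f : Edge d) : edist e f = edist f e := nrm_sub_comm _ _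

/-- The edges with exactly one end point in `A`. -/
def bdry {d : ℕ} (A : Finset (Site d)) : Finset (Edge d) :=
  ((A ×ˢ Finset.univ) ∪ (A ×ˢ Finset.univ).image fun e : Edge d => (e.1 - unit e.2, e.2)).filter
    fun e => ¬ (e.1 ∈ A ↔ e.1 + unit e.2 ∈ A)

theorem mem_bdry {d : ℕ} {A : Finset (Site d)} {e : Edge d} :
    e ∈ bdry A ↔ ¬ (e.1 ∈ A ↔ e.1 + unit e.2 ∈ A) := by
  unfold bdry
  rw [Finset.mem_filter, and_iff_right_iff_imp]
  intro h
  by_cases h1 : e.1 ∈ A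
  · simp [h1]
  · have h2 : e.1 + unit e.2 ∈ A := by tauto
    rw [Finset.mem_union, Finset.mem_image]
    exact Or.inr ⟨(e.1 + unit e.2, e.2), by simp [h2], by simp⟩

/-- A lattice path from `x` to `y` of length `nrm (x - y)` crosses the boundary of every set that
separates them. -/
theorem exists_mem_bdry_of_separates {d : ℕ} {A : Finset (Site d)} {x y : Site d}
    (h : ¬ (x ∈ A ↔ y ∈ A)) : ∃ e ∈ bdry A, nrm (e.1 - x) ≤ nrm (x - y) := by
  induction hn : nrm (x - y) generalizing x with
  | zero =>
    have : x = y := sub_eq_zero.1 (nrm_eq_zero.1 hn)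
    subst this
    exact absurd Iff.rfl h
  | succ n ih =>
    have hne : x - y ≠ 0 := by
      intro h0
      simp [h0] at hn
    obtain ⟨i, hi⟩ := Function.ne_iff.1 hne
    have key : ∃ s : ℤ, (s = 1 ∨ s = -1) ∧ nrm (x + s • unit i - y) = n := by
      have hs : ∃ s : ℤ, (s = 1 ∨ s = -1) ∧ (x i + s - y i).natAbs + 1 = (x i - y i).natAbs := by
        simp only [Pi.sub_apply, Pi.zero_apply] at hi
        rcases lt_or_gt_of_ne hi with h1 | h1
        · exact ⟨1, by simp, by omega⟩
        · exact ⟨-1, by simp, by omega⟩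
      obtain ⟨s, hs1, hs2⟩ := hs
      refine ⟨s, hs1, ?_⟩
      unfold nrm at hn ⊢
      rw [← Finset.add_sum_erase _ _ (Finset.mem_univ i)] at hn ⊢
      have : ∑ j ∈ Finset.univ.erase i, ((x + s • unit i - y) j).natAbs
          = ∑ j ∈ Finset.univ.erase i, ((x - y) j).natAbs := by
        refine Finset.sum_congr rfl fun j hj => ?_
        simp [unit_ne (Finset.ne_of_mem_erase hj)]
      rw [this]
      simp only [Pi.sub_apply, Pi.add_apply, Pi.smul_apply, unit_self, smul_eq_mul, mul_one] at hn ⊢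
      omega
    obtain ⟨s, hs, hsn⟩ := key
    by_cases hx : x ∈ A ↔ x + s • unit i ∈ A
    · obtain ⟨e, he, hle⟩ := ih (x := x + s • unit i) (by tauto) hsn
      refine ⟨e, he, ?_⟩
      have h1 := nrm_sub_le e.1 (x + s • unit i) x
      have h2 : nrm (x + s • unit i - x) = 1 := by
        rw [add_sub_cancel_left, nrm_smul_unit]; omega
      omega
    · rcases hs with rfl | rfl
      · refine ⟨(x, i), mem_bdry.2 (by simpa using hx), by simp⟩
      · refine ⟨(x - unit i, i), mem_bdry.2 ?_, by simp⟩
        simp only [neg_smul, one_smul, ← sub_eq_add_neg] at hx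
        simp only [sub_add_cancel]
        tauto

/-- Going from a point of `A` in direction `i`, one leaves `A` within `A.card` steps. -/
theorem exists_exit {d : ℕ} {A : Finset (Site d)} {x : Site d} (hx : x ∈ A) (i : Fin d) :
    ∃ k : ℕ, k < A.card ∧ x + (k : ℤ) • unit i ∈ A ∧ x + ((k : ℤ) + 1) • unit i ∉ A := by
  have hinj : Function.Injective fun k : ℕ => x + (k : ℤ) • unit i := by
    intro k l h
    have := congrFun h i
    simpa using this
  have hex : ∃ k : ℕ, x + ((k : ℤ) + 1) • unit i ∉ A := by
    by_contra hc
    push Not at hc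
    have hinj' : Function.Injective fun k : ℕ => x + ((k : ℤ) + 1) • unit i := by
      intro k l h
      have := congrFun h i
      simpa using this
    exact Set.infinite_of_injective_forall_mem hinj' hc A.finite_toSet
  classical
  have hlt : ∀ k < Nat.find hex + 1, x + (k : ℤ) • unit i ∈ A := by
    intro k hk
    rcases Nat.eq_zero_or_pos k with rfl | hk0
    · simpa using hx
    · have := Nat.find_min hex (m := k - 1) (by omega)
      rw [not_not] at this
      convert this using 3
      push_cast [hk0]
      ring
  refine ⟨Nat.find hex, ?_, hlt _ (by omega), Nat.find_spec hex⟩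
  have := Finset.card_le_card_of_injOn (s := Finset.range (Nat.find hex + 1)) (t := A) _
    (fun k hk => hlt k (by simpa using hk)) hinj.injOn
  simpa using this

/-- A crude isoperimetric inequality: the edge through which the ray from `x` in one direction
leaves `A` determines all other coordinates of `x`, so the exit edges in two different directions
determine `x`. -/
theorem card_le_sq_card_bdry {d : ℕ} (hd : 2 ≤ d) (A : Finset (Site d)) :
    A.card ≤ (bdry A).card ^ 2 := by
  classical
  let i₀ : Fin d := ⟨0, by omega⟩
  let i₁ : Fin d := ⟨1, by omega⟩
  have h01 : i₁ ≠ i₀ := by simp [i₀, i₁]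
  choose! f hf1 hf2 hf3 using fun (x : Site d) (hx : x ∈ A) => exists_exit hx i₀
  choose! g hg1 hg2 hg3 using fun (x : Site d) (hx : x ∈ A) => exists_exit hx i₁
  rw [sq, ← Finset.card_product]
  refine Finset.card_le_card_of_injOn
    (fun x => ((x + (f x : ℤ) • unit i₀, i₀), (x + (g x : ℤ) • unit i₁, i₁))) ?_ ?_
  · intro x hx
    have e1 := hf3 x hx
    have e2 := hg3 x hx
    rw [add_smul, one_smul, ← add_assoc] at e1 e2
    simp only [Finset.coe_product, Set.mem_prod, Finset.mem_coe]
    refine ⟨mem_bdry.2 ?_, mem_bdry.2 ?_⟩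
    · have := hf2 x hx
      simp only; tauto
    · have := hg2 x hx
      simp only; tauto
  · intro x _ y _ hxy
    simp only [Prod.mk.injEq, and_true] at hxy
    funext j
    by_cases hj : j = i₀
    · have := congrFun hxy.2 j
      simpa [unit_ne (hj ▸ h01.symm : j ≠ i₁)] using this
    · have := congrFun hxy.1 j
      simpa [unit_ne hj] using this

/-- A ray from `x` stays in `A` for fewer than `A.card` steps, and `A.card` is at most the square of
the perimeter. Thus distances inside a contour are controlled by its length alone. -/
theorem exists_mem_bdry_near {d : ℕ} (hd : 2 ≤ d) {A : Finset (Site d)} {x : Site d} (hx : x ∈ A) :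
    ∃ e ∈ bdry A, nrm (e.1 - x) ≤ (bdry A).card ^ 2 := by
  obtain ⟨k, hk, h1, h2⟩ := exists_exit hx ⟨0, by omega⟩
  refine ⟨(x + (k : ℤ) • unit ⟨0, by omega⟩, ⟨0, by omega⟩), mem_bdry.2 ?_, ?_⟩
  · rw [add_smul, one_smul, ← add_assoc] at h2
    simp only; tauto
  · have := card_le_sq_card_bdry hd A
    simp only [add_sub_cancel_left, nrm_smul_unit, Int.natAbs_natCast]
    omega

/-! ### Boundaries as cocycles mod 2 -/

/-- The indicator function mod `2`. -/
def ind {d : ℕ} (A : Finset (Site d)) (x : Site d) : ZMod 2 := if x ∈ A then 1 else 0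

theorem ind_eq_ind {d : ℕ} {A B : Finset (Site d)} {x y : Site d} :
    ind A x = ind B y ↔ (x ∈ A ↔ y ∈ B) := by
  unfold ind
  by_cases h1 : x ∈ A <;> by_cases h2 : y ∈ B <;> simp [h1, h2]

/-- A function with finite support that is constant along all edges vanishes. -/
theorem eq_zero_of_const_on_edges {d : ℕ} (i : Fin d) {f : Site d → ZMod 2}
    (S : Finset (Site d)) (hS : ∀ x, f x ≠ 0 → x ∈ S) (hf : ∀ x, f (x + unit i) = f x) :
    f = 0 := by
  funext x
  by_contra hx
  have hk : ∀ k : ℕ, f (x + (k : ℤ) • unit i) = f x := by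
    intro k
    induction k with
    | zero => simp
    | succ k ih =>
      rw [← ih, ← hf (x + (k : ℤ) • unit i)]
      congr 1
      push_cast
      rw [add_smul, one_smul, add_assoc]
  have hinj : Function.Injective fun k : ℕ => x + (k : ℤ) • unit i := by
    intro k l h
    have := congrFun h i
    simpa using this
  exact Set.infinite_of_injective_forall_mem hinj (s := S)
    (fun k => hS _ (by rw [hk]; exact hx)) S.finite_toSet

/-- A finite set of edges that meets every plaquette in an even number of edges is a boundary. -/
theorem exists_bdry_eq {d : ℕ} (hd : 2 ≤ d) (γ : Finset (Edge d))
    (hγ : ∀ (x : Site d) (i j : Fin d), i ≠ j →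
      ((if (x, i) ∈ γ then 1 else 0) + (if (x + unit i, j) ∈ γ then 1 else 0) : ZMod 2)
        = (if (x, j) ∈ γ then 1 else 0) + (if (x + unit j, i) ∈ γ then 1 else 0)) :
    ∃ A : Finset (Site d), bdry A = γ := by
  classical
  let i₀ : Fin d := ⟨0, by omega⟩
  let i₁ : Fin d := ⟨1, by omega⟩
  have h01 : i₁ ≠ i₀ := by simp [i₀, i₁]
  let c : Site d → Fin d → ZMod 2 := fun x i => if (x, i) ∈ γ then 1 else 0
  obtain ⟨N, hN⟩ : ∃ N : ℕ, ∀ e ∈ γ, nrm e.1 ≤ N :=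
    ⟨γ.sup fun e => nrm e.1, fun e he => Finset.le_sup (f := fun e : Edge d => nrm e.1) he⟩
  have hN' : ∀ x i, (∃ j, (N : ℤ) < |x j|) → c x i = 0 := by
    rintro x i ⟨j, hj⟩
    simp only [c, ite_eq_right_iff, one_ne_zero, imp_false]
    intro hm
    have h1 := hN _ hm
    have h2 : (x j).natAbs ≤ nrm x :=
      Finset.single_le_sum (f := fun i => (x i).natAbs) (fun _ _ => Nat.zero_le _)
        (Finset.mem_univ j)
    rw [Int.abs_eq_natAbs] at hj
    simp only at h1
    omega
  -- sums along rays, started `n` steps away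
  have hray : ∀ (x : Site d) (k : ℕ) (i : Fin d), (N : ℤ) < x i₀ + k →
      c (x + (k : ℤ) • unit i₀) i = 0 := by
    intro x k i hk
    refine hN' _ _ ⟨i₀, ?_⟩
    simp only [Pi.add_apply, Pi.smul_apply, unit_self, smul_eq_mul, mul_one]
    exact lt_of_lt_of_le hk (le_abs_self _)
  -- `f x` is the parity of the number of edges of `γ` on the ray from `x` in direction `i₀`; `len
  -- x` steps lead past `γ`. The set sought is `{f ≠ 0}`.
  let len : Site d → ℕ := fun x => N + 1 + (x i₀).natAbs
  let f : Site d → ZMod 2 := fun x => ∑ k ∈ Finset.range (len x), c (x + (k : ℤ) • unit i₀) i₀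
  have hf : ∀ x n, len x ≤ n → f x = ∑ k ∈ Finset.range n, c (x + (k : ℤ) • unit i₀) i₀ := by
    intro x n hn
    refine Finset.sum_subset (Finset.range_mono hn) fun k _ hk => hray _ _ _ ?_
    simp only [Finset.mem_range, not_lt, len] at hk
    omega
  have hstep : ∀ x i, f (x + unit i) = f x + c x i := by
    intro x i
    set n := max (len x) (len (x + unit i)) with hn
    have two : ∀ a b : ZMod 2, a + a = 0 ∧ (a + b = b + a) := by decide
    by_cases hi : i = i₀
    · subst hi
      rw [hf x (n + 1) (by omega), hf (x + unit i₀) n (by omega), Finset.sum_range_succ']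
      simp only [Nat.cast_zero, zero_smul, add_zero]
      rw [add_assoc, (two (c x i₀) 0).1, add_zero]
      refine Finset.sum_congr rfl fun k _ => ?_
      congr 1
      push_cast
      rw [add_smul, one_smul]
      abel
    · rw [hf x n (by omega), hf (x + unit i) n (by omega)]
      -- The plaquettes between the two parallel rays make the difference of the two sums telescope;
      -- the far end vanishes, and the sign of the near end is invisible mod 2.
      have hpl : ∀ k : ℕ, c (x + unit i + (k : ℤ) • unit i₀) i₀
          = c (x + (k : ℤ) • unit i₀) i₀
            + (c (x + ((k + 1 : ℕ) : ℤ) • unit i₀) i - c (x + (k : ℤ) • unit i₀) i) := by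
        intro k
        have := hγ (x + (k : ℤ) • unit i₀) i i₀ hi
        have e1 : x + (k : ℤ) • unit i₀ + unit i = x + unit i + (k : ℤ) • unit i₀ := by abel
        have e2 : x + (k : ℤ) • unit i₀ + unit i₀ = x + ((k + 1 : ℕ) : ℤ) • unit i₀ := by
          push_cast
          rw [add_smul, one_smul, add_assoc]
        rw [e1, e2] at this
        change c _ _ + c _ _ = c _ _ + c _ _ at this
        linear_combination this
      rw [Finset.sum_congr rfl fun k _ => hpl k, Finset.sum_add_distrib,
        Finset.sum_range_sub (fun k : ℕ => c (x + (k : ℤ) • unit i₀) i)]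
      rw [hray x n i (by simp only [len] at hn; omega)]
      have : ∀ a : ZMod 2, 0 - a = a := by decide
      rw [this]
      simp
  have hzero : ∀ x, (∃ j, (N : ℤ) < |x j|) → f x = 0 := by
    have hA : ∀ x : Site d, (∃ j, j ≠ i₀ ∧ (N : ℤ) < |x j|) → f x = 0 := by
      rintro x ⟨j, hj, hlt⟩
      refine Finset.sum_eq_zero fun k _ => hN' _ _ ⟨j, ?_⟩
      simpa [unit_ne hj] using hlt
    rintro x ⟨j, hj⟩
    by_cases hj0 : j = i₀
    -- The ray from `x` may meet `γ` here. Instead `x` is moved in direction `i₁`, along edges that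
    -- are not in `γ`, until its coordinate `i₁` exceeds `N`. This uses a second dimension.
    · subst hj0
      have hup : ∀ k : ℕ, f (x + (k : ℤ) • unit i₁) = f x := by
        intro k
        induction k with
        | zero => simp
        | succ k ih =>
          have := hstep (x + (k : ℤ) • unit i₁) i₁
          rw [hN' _ _ ⟨i₀, by simpa [unit_ne h01.symm] using hj⟩, add_zero, ih] at this
          rw [← this]
          congr 1
          push_cast
          rw [add_smul, one_smul, add_assoc]
      rw [← hup (N + 1 + (x i₁).natAbs)]
      refine hA _ ⟨i₁, h01, ?_⟩
      simp only [Pi.add_apply, Pi.smul_apply, unit_self, smul_eq_mul, mul_one]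
      refine lt_of_lt_of_le ?_ (le_abs_self _)
      push_cast
      have := neg_abs_le (x i₁)
      omega
    · exact hA x ⟨j, hj0, hj⟩
  let box : Finset (Site d) := Finset.Icc (fun _ => -(N : ℤ)) (fun _ => (N : ℤ))
  have hbox : ∀ x, f x ≠ 0 → x ∈ box := by
    intro x hx
    have : ¬ ∃ j, (N : ℤ) < |x j| := fun h => hx (hzero x h)
    push Not at this
    rw [Finset.mem_Icc]
    exact ⟨fun j => (abs_le.1 (this j)).1, fun j => (abs_le.1 (this j)).2⟩
  refine ⟨box.filter fun x => f x ≠ 0, ?_⟩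
  have hmem : ∀ x, x ∈ box.filter (fun x => f x ≠ 0) ↔ f x ≠ 0 := by
    intro x
    rw [Finset.mem_filter, and_iff_right_iff_imp]
    exact hbox x
  ext ⟨x, i⟩
  rw [mem_bdry]
  simp only [hmem, hstep]
  have : ∀ a b : ZMod 2, (¬ (a ≠ 0 ↔ a + b ≠ 0)) ↔ b = 1 := by decide
  rw [this]
  simp [c]

/-- The boundary of a set meets every plaquette in an even number of edges. -/
theorem bdry_plaquette {d : ℕ} (A : Finset (Site d)) (x : Site d) (i j : Fin d) :
    ((if (x, i) ∈ bdry A then 1 else 0) + (if (x + unit i, j) ∈ bdry A then 1 else 0) : ZMod 2)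
      = (if (x, j) ∈ bdry A then 1 else 0) + (if (x + unit j, i) ∈ bdry A then 1 else 0) := by
  have e : ∀ y k, (if (y, k) ∈ bdry A then 1 else 0 : ZMod 2) = ind A y + ind A (y + unit k) := by
    intro y k
    simp only [mem_bdry, ind]
    by_cases h1 : y ∈ A <;> by_cases h2 : y + unit k ∈ A <;> simp [h1, h2]; decide
  simp only [e]
  have e2 : x + unit i + unit j = x + unit j + unit i := by abel
  rw [e2]
  have : ∀ a b c f : ZMod 2, a + b + (b + c) = a + f + (f + c) := by decide
  exact this _ _ _ _

theorem bdry_ite_eq {d : ℕ} (A : Finset (Site d)) (e : Edge d) :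
    (if e ∈ bdry A then 1 else 0 : ZMod 2) = ind A (e.1 + unit e.2) - ind A e.1 := by
  simp only [mem_bdry, ind]
  by_cases h1 : e.1 ∈ A <;> by_cases h2 : e.1 + unit e.2 ∈ A <;> simp [h1, h2]

/-- If the boundary of `P` is the disjoint union of the boundaries of the `A j`, then the
indicator of `P` is the sum mod `2` of the indicators of the `A j`. -/
theorem ind_eq_sum {d : ℕ} (i : Fin d) {ι : Type*} (s : Finset ι) (A : ι → Finset (Site d))
    (P : Finset (Site d)) (hmem : ∀ e, e ∈ bdry P ↔ ∃ j ∈ s, e ∈ bdry (A j))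
    (hdisj : ∀ j ∈ s, ∀ k ∈ s, j ≠ k → Disjoint (bdry (A j)) (bdry (A k))) (x : Site d) :
    ind P x = ∑ j ∈ s, ind (A j) x := by
  classical
  have := eq_zero_of_const_on_edges i (f := fun x => ind P x - ∑ j ∈ s, ind (A j) x)
    (P ∪ s.biUnion A) ?_ ?_
  · exact sub_eq_zero.1 (congrFun this x)
  · intro x hx
    by_contra hc
    simp only [Finset.mem_union, Finset.mem_biUnion, not_or, not_exists, not_and] at hc
    apply hx
    rw [Finset.sum_eq_zero fun j hj => by simp [ind, hc.2 j hj]]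
    simp [ind, hc.1]
  · intro x
    have h1 := bdry_ite_eq P (x, i)
    have h2 : ∑ j ∈ s, (if (x, i) ∈ bdry (A j) then 1 else 0 : ZMod 2)
        = ∑ j ∈ s, ind (A j) (x + unit i) - ∑ j ∈ s, ind (A j) x := by
      rw [← Finset.sum_sub_distrib]
      exact Finset.sum_congr rfl fun j _ => bdry_ite_eq (A j) (x, i)
    have h3 : (if (x, i) ∈ bdry P then 1 else 0 : ZMod 2)
        = ∑ j ∈ s, (if (x, i) ∈ bdry (A j) then 1 else 0 : ZMod 2) := by
      by_cases he : (x, i) ∈ bdry P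
      · obtain ⟨j, hj, hm⟩ := (hmem _).1 he
        rw [Finset.sum_eq_single j]
        · simp [he, hm]
        · intro k hk hkj
          rw [if_neg]
          exact fun hm' => Finset.disjoint_left.1 (hdisj k hk j hj hkj) hm' hm
        · exact fun h => absurd hj h
      · rw [if_neg he, Finset.sum_eq_zero]
        intro j hj
        rw [if_neg]
        exact fun hm => he ((hmem _).2 ⟨j, hj, hm⟩)
    simp only at h1
    rw [h3, h2] at h1
    linear_combination -h1

/-- The case of one summand in `ind_eq_sum`. It allows contours to be counted through their
boundaries. -/
theorem bdry_injective {d : ℕ} (i : Fin d) {A B : Finset (Site d)} (h : bdry A = bdry B) :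
    A = B := by
  ext x
  rw [← ind_eq_ind]
  simpa using ind_eq_sum i {()} (fun _ => B) A (by simp [h]) (by simp) x

/-! ### Summability on the lattice and weighted walks -/

theorem summable_pi_prod {g : ℤ → ℝ} (hg0 : ∀ t, 0 ≤ g t) (hg : Summable g) (d : ℕ) :
    Summable fun x : Fin d → ℤ => ∏ i, g (x i) := by
  induction d with
  | zero => exact Summable.of_finite
  | succ d ih =>
    rw [← (Fin.consEquiv fun _ : Fin (d + 1) => ℤ).summable_iff]
    refine (hg.mul_of_nonneg ih hg0 fun x => Finset.prod_nonneg fun _ _ => hg0 _).congr ?_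
    rintro ⟨t, x⟩
    simp [Fin.prod_univ_succ, Fin.consEquiv]

theorem summable_int_rpow {q : ℝ} (hq : 1 < q) :
    Summable fun t : ℤ => (1 + (t.natAbs : ℝ)) ^ (-q) := by
  have h : Summable fun n : ℕ => (1 + (n : ℝ)) ^ (-q) := by
    have := (summable_nat_add_iff 1).2 (Real.summable_nat_rpow.2 (by linarith : -q < -1))
    simpa [add_comm] using this
  refine Summable.of_nat_of_neg ?_ ?_ <;> simpa using h

/-- Split the power into `d` factors with exponent `p / d > 1` and bound the norm in the `i`-th
factor below by `|x i|`; the resulting product of one-dimensional series converges. -/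
theorem summable_nrm_rpow {d : ℕ} {p : ℝ} (hd : 0 < d) (hp : (d : ℝ) < p) :
    Summable fun x : Site d => (1 + (nrm x : ℝ)) ^ (-p) := by
  have hd' : (0 : ℝ) < d := by exact_mod_cast hd
  have hq : 1 < p / d := by rwa [one_lt_div hd']
  refine Summable.of_nonneg_of_le (fun x => by positivity) (fun x => ?_)
    (summable_pi_prod (fun t => by positivity) (summable_int_rpow hq) d)
  have : (1 + (nrm x : ℝ)) ^ (-p) = ∏ _i : Fin d, (1 + (nrm x : ℝ)) ^ (-(p / d)) := by
    rw [Finset.prod_const, Finset.card_univ, Fintype.card_fin, ← Real.rpow_mul_natCast (by positivity)]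
    congr 1
    field_simp
  rw [this]
  refine Finset.prod_le_prod (fun _ _ => by positivity) fun i _ => ?_
  refine Real.rpow_le_rpow_of_nonpos (by positivity) ?_ (by linarith)
  have : (x i).natAbs ≤ nrm x :=
    Finset.single_le_sum (f := fun i => (x i).natAbs) (fun _ _ => Nat.zero_le _)
      (Finset.mem_univ i)
  have : ((x i).natAbs : ℝ) ≤ nrm x := by exact_mod_cast this
  linarith

/-- The weight of a step with displacement `v`. -/
noncomputable def stepWeight {d : ℕ} (η : ℝ) (s : Edge d) : ℝ := η / (1 + (nrm s.1 : ℝ)) ^ (d + 1)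

theorem summable_stepWeight {d : ℕ} (hd : 0 < d) (η : ℝ) :
    Summable fun s : Edge d => stepWeight η s := by
  have h1 : Summable fun x : Site d => η / (1 + (nrm x : ℝ)) ^ (d + 1) := by
    refine ((summable_nrm_rpow hd (p := (d + 1 : ℕ)) (by push_cast; linarith)).mul_left η).congr ?_
    intro x
    rw [Real.rpow_neg (by positivity), Real.rpow_natCast, div_eq_mul_inv]
  rw [← (Equiv.prodComm _ _).summable_iff]
  have h2 := summable_prod_of_nonneg (f := fun p : Fin d × Site d => |stepWeight η (p.2, p.1)|)
    (fun _ => abs_nonneg _)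
  refine Summable.of_abs ((h2.2 ⟨fun i => h1.abs, Summable.of_finite⟩).congr fun _ => rfl)

/-- The exponent `d + 1` exceeds the dimension, so the weights are summable and `η` can be scaled
down. The bound 1/2 makes the sum over walks a geometric series. -/
theorem exists_stepWeight {d : ℕ} (hd : 0 < d) :
    ∃ η : ℝ, 0 < η ∧ η ≤ 1 ∧ ∀ F : Finset (Edge d), ∑ s ∈ F, stepWeight η s ≤ 1 / 2 := by
  have hs := summable_stepWeight (d := d) hd 1
  set T := ∑' s : Edge d, stepWeight (1 : ℝ) s with hT
  have hnn : ∀ s : Edge d, 0 ≤ stepWeight (1 : ℝ) s := fun s => by unfold stepWeight; positivity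
  have hT0 : 0 ≤ T := tsum_nonneg hnn
  refine ⟨1 / (2 * (T + 1)), by positivity, ?_, fun F => ?_⟩
  · rw [div_le_one (by positivity)]
    linarith
  · have h1 : ∑ s ∈ F, stepWeight (1 : ℝ) s ≤ T := hs.sum_le_tsum _ fun s _ => hnn s
    have h2 : ∀ s : Edge d, stepWeight (1 / (2 * (T + 1))) s
        = 1 / (2 * (T + 1)) * stepWeight (1 : ℝ) s := fun s => by unfold stepWeight; ring
    rw [Finset.sum_congr rfl fun s _ => h2 s, ← Finset.mul_sum]
    calc _ ≤ 1 / (2 * (T + 1)) * T := by gcongr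
      _ ≤ 1 / 2 := by
        rw [div_mul_eq_mul_div, div_le_div_iff₀ (by positivity) (by positivity)]
        linarith

/-- The weight of a list of steps. -/
noncomputable def walkWeight {d : ℕ} (η : ℝ) (l : List (Edge d)) : ℝ :=
  (l.map (stepWeight η)).prod

/-- The edge reached from `p` by the step `s`. -/
def next {d : ℕ} (p s : Edge d) : Edge d := (p.1 + s.1, s.2)

/-- The end point of a walk started at `p`. -/
def endpt {d : ℕ} (p : Edge d) (l : List (Edge d)) : Edge d := l.foldl next p

/-- The set of edges visited by a walk started at `p`. -/
def visit {d : ℕ} (p : Edge d) : List (Edge d) → Finset (Edge d)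
  | [] => {p}
  | s :: l => insert p (visit (next p s) l)

theorem stepWeight_pos {d : ℕ} {η : ℝ} (hη : 0 < η) (s : Edge d) : 0 < stepWeight η s := by
  unfold stepWeight; positivity

theorem stepWeight_mul_le {d : ℕ} {η : ℝ} (hη : η ≤ 1) (s : Edge d) :
    stepWeight η s * (1 + (nrm s.1 : ℝ)) ≤ 1 := by
  unfold stepWeight
  rw [div_mul_eq_mul_div, div_le_one (by positivity), pow_succ]
  have : 1 ≤ (1 + (nrm s.1 : ℝ)) ^ d := one_le_pow₀ (by simp)
  gcongr
  linarith

@[simp] theorem walkWeight_nil {d : ℕ} (η : ℝ) : walkWeight η ([] : List (Edge d)) = 1 := rfl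

@[simp] theorem walkWeight_cons {d : ℕ} (η : ℝ) (s : Edge d) (l : List (Edge d)) :
    walkWeight η (s :: l) = stepWeight η s * walkWeight η l := by simp [walkWeight]

@[simp] theorem walkWeight_append {d : ℕ} (η : ℝ) (l l' : List (Edge d)) :
    walkWeight η (l ++ l') = walkWeight η l * walkWeight η l' := by simp [walkWeight]

theorem walkWeight_pos {d : ℕ} {η : ℝ} (hη : 0 < η) (l : List (Edge d)) : 0 < walkWeight η l := by
  induction l with
  | nil => simp
  | cons s l ih => rw [walkWeight_cons]; exact mul_pos (stepWeight_pos hη s) ih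

@[simp] theorem endpt_nil {d : ℕ} (p : Edge d) : endpt p [] = p := rfl

@[simp] theorem endpt_cons {d : ℕ} (p s : Edge d) (l : List (Edge d)) :
    endpt p (s :: l) = endpt (next p s) l := rfl

@[simp] theorem endpt_append {d : ℕ} (p : Edge d) (l l' : List (Edge d)) :
    endpt p (l ++ l') = endpt (endpt p l) l' := by simp [endpt]

theorem visit_append {d : ℕ} (p : Edge d) (l l' : List (Edge d)) :
    visit p (l ++ l') = visit p l ∪ visit (endpt p l) l' := by
  induction l generalizing p with
  | nil =>
    cases l' <;> simp [visit]
  | cons s l ih => simp [visit, ih, Finset.insert_union]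

theorem mem_visit {d : ℕ} {p e : Edge d} {l : List (Edge d)} (h : e ∈ visit p l) :
    ∃ l₁ l₂, l = l₁ ++ l₂ ∧ endpt p l₁ = e := by
  induction l generalizing p with
  | nil =>
    simp only [visit, Finset.mem_singleton] at h
    exact ⟨[], [], rfl, h.symm⟩
  | cons s l ih =>
    simp only [visit, Finset.mem_insert] at h
    rcases h with rfl | h
    · exact ⟨[], s :: l, rfl, rfl⟩
    · obtain ⟨l₁, l₂, rfl, h2⟩ := ih h
      exact ⟨s :: l₁, l₂, rfl, h2⟩

/-- A step with displacement `v` has weight at most `1 / (1 + |v|)`, and `1 + |v + w| ≤ (1 + |v|) (1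
+ |w|)`. -/
theorem walkWeight_mul_le {d : ℕ} {η : ℝ} (hη0 : 0 < η) (hη : η ≤ 1) (p : Edge d)
    (l : List (Edge d)) : walkWeight η l * (1 + (nrm ((endpt p l).1 - p.1) : ℝ)) ≤ 1 := by
  induction l generalizing p with
  | nil => simp
  | cons s l ih =>
    rw [walkWeight_cons, endpt_cons]
    have h1 := ih (next p s)
    have h2 := stepWeight_mul_le hη s
    have h3 : (nrm ((endpt (next p s) l).1 - p.1) : ℝ)
        ≤ nrm ((endpt (next p s) l).1 - (next p s).1) + nrm s.1 := by
      have := nrm_sub_le (endpt (next p s) l).1 (next p s).1 p.1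
      have e : (next p s).1 - p.1 = s.1 := by simp [next]
      rw [e] at this
      exact_mod_cast this
    have h4 := stepWeight_pos hη0 s
    have h5 := walkWeight_pos hη0 l
    set N := (nrm ((endpt (next p s) l).1 - (next p s).1) : ℝ)
    have hN : 0 ≤ N := Nat.cast_nonneg _
    have hs : (0 : ℝ) ≤ nrm s.1 := Nat.cast_nonneg _
    calc _ ≤ stepWeight η s * walkWeight η l * ((1 + nrm s.1) * (1 + N)) := by
          gcongr
          nlinarith
      _ = (stepWeight η s * (1 + nrm s.1)) * (walkWeight η l * (1 + N)) := by ring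
      _ ≤ 1 * 1 := by
          gcongr
      _ = 1 := one_mul 1

theorem walkWeight_le_one {d : ℕ} {η : ℝ} (hη0 : 0 < η) (hη : η ≤ 1) (l : List (Edge d)) :
    walkWeight η l ≤ 1 := by
  induction l with
  | nil => simp
  | cons s l ih =>
    rw [walkWeight_cons]
    have h2 := stepWeight_mul_le hη s
    have h4 := stepWeight_pos hη0 s
    have hs : (0 : ℝ) ≤ nrm s.1 := Nat.cast_nonneg _
    exact mul_le_one₀ (by nlinarith) (walkWeight_pos hη0 l).le ih

/-- The total weight of any finite set of walks is at most `2` if the steps have total weight at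
most `1 / 2`. -/
theorem sum_walkWeight_le {d : ℕ} {η : ℝ} (hη0 : 0 < η)
    (hη : ∀ F : Finset (Edge d), ∑ s ∈ F, stepWeight η s ≤ 1 / 2) (S : Finset (List (Edge d))) :
    ∑ l ∈ S, walkWeight η l ≤ 2 := by
  classical
  -- The walks in `S` are words of length at most `N` over the finite alphabet `F`, and the words of
  -- length `n` have total weight at most `(1 / 2) ^ n`.
  let F : Finset (Edge d) := S.biUnion fun l => l.toFinset
  obtain ⟨N, hN⟩ : ∃ N : ℕ, ∀ l ∈ S, l.length ≤ N :=
    ⟨S.sup List.length, fun l hl => Finset.le_sup (f := List.length) hl⟩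
  let walks : ℕ → Finset (List (Edge d)) := fun n =>
    Nat.rec {[]} (fun _ T => (F ×ˢ T).image fun p => p.1 :: p.2) n
  have hwalks : ∀ l : List (Edge d), (∀ s ∈ l, s ∈ F) → l ∈ walks l.length := by
    intro l
    induction l with
    | nil => intro _; simp [walks]
    | cons s l ih =>
      intro h
      have := ih fun t ht => h t (List.mem_cons_of_mem _ ht)
      simp only [List.length_cons]
      change s :: l ∈ (F ×ˢ walks l.length).image fun p => p.1 :: p.2
      exact Finset.mem_image.2 ⟨(s, l), Finset.mem_product.2 ⟨h s List.mem_cons_self, this⟩, rfl⟩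
  have hsum : ∀ n, ∑ l ∈ walks n, walkWeight η l ≤ (1 / 2) ^ n := by
    intro n
    induction n with
    | zero => simp [walks]
    | succ n ih =>
      change ∑ l ∈ (F ×ˢ walks n).image (fun p => p.1 :: p.2), walkWeight η l ≤ _
      rw [Finset.sum_image (by rintro ⟨a, b⟩ _ ⟨c, e⟩ _ h; simpa using h), Finset.sum_product]
      simp only [walkWeight_cons, ← Finset.mul_sum, ← Finset.sum_mul]
      rw [pow_succ']
      exact mul_le_mul (hη F) ih (Finset.sum_nonneg fun l _ => (walkWeight_pos hη0 l).le) (by norm_num)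
  calc ∑ l ∈ S, walkWeight η l
      ≤ ∑ l ∈ (Finset.range (N + 1)).biUnion walks, walkWeight η l := by
        refine Finset.sum_le_sum_of_subset_of_nonneg (fun l hl => ?_)
          fun l _ _ => (walkWeight_pos hη0 l).le
        refine Finset.mem_biUnion.2 ⟨l.length, Finset.mem_range.2 (Nat.lt_succ_of_le (hN l hl)),
          hwalks l fun s hs => Finset.mem_biUnion.2 ⟨l, hl, List.mem_toFinset.2 hs⟩⟩
    _ ≤ ∑ n ∈ Finset.range (N + 1), ∑ l ∈ walks n, walkWeight η l := by
        have hlen : ∀ n, ∀ l ∈ walks n, l.length = n := by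
          intro n
          induction n with
          | zero => simp [walks]
          | succ n ih =>
            intro l hl
            obtain ⟨⟨s, l'⟩, h1, rfl⟩ := Finset.mem_image.1
              (show l ∈ (F ×ˢ walks n).image (fun p => p.1 :: p.2) from hl)
            simp [ih l' (Finset.mem_product.1 h1).2]
        rw [Finset.sum_biUnion]
        intro m _ n _ hmn
        rw [Function.onFun, Finset.disjoint_left]
        intro l h1 h2
        exact hmn ((hlen m l h1).symm.trans (hlen n l h2))
    _ ≤ ∑ n ∈ Finset.range (N + 1), (1 / 2 : ℝ) ^ n := Finset.sum_le_sum fun n _ => hsum n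
    _ ≤ 2 := sum_geometric_two_le _

/-- From every edge of `B` there is a closed walk of weight at least `c` that visits exactly the
edges of `B`. -/
def Walkable {d : ℕ} (η c : ℝ) (B : Finset (Edge d)) : Prop :=
  ∀ e ∈ B, ∃ l, visit e l = B ∧ endpt e l = e ∧ c ≤ walkWeight η l

theorem walkable_singleton {d : ℕ} (η : ℝ) (e : Edge d) : Walkable η 1 {e} := by
  intro f hf
  rw [Finset.mem_singleton] at hf
  subst hf
  exact ⟨[], rfl, rfl, by simp⟩

theorem Walkable.mono {d : ℕ} {η c c' : ℝ} {B : Finset (Edge d)} (h : Walkable η c B)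
    (hc : c' ≤ c) : Walkable η c' B := fun e he => by
  obtain ⟨l, h1, h2, h3⟩ := h e he
  exact ⟨l, h1, h2, hc.trans h3⟩

theorem Walkable.union {d : ℕ} {η c c' : ℝ} (hη : 0 < η) (hc : 0 ≤ c) (hc' : 0 ≤ c')
    {B B' : Finset (Edge d)} (h : Walkable η c B) (h' : Walkable η c' B') {e e' : Edge d}
    (he : e ∈ B) (he' : e' ∈ B') :
    Walkable η (c * c' * (η / (1 + (edist e e' : ℝ)) ^ (d + 1)) ^ 2) (B ∪ B') := by
  have key : ∀ {c c' : ℝ} {B B' : Finset (Edge d)} {e e' : Edge d}, 0 ≤ c → 0 ≤ c' →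
      Walkable η c B → Walkable η c' B' → e ∈ B → e' ∈ B' → ∀ p ∈ B, ∃ l,
      visit p l = B ∪ B' ∧ endpt p l = p ∧
        c * c' * (η / (1 + (edist e e' : ℝ)) ^ (d + 1)) ^ 2 ≤ walkWeight η l := by
    intro c c' B B' e e' hc hc' h h' he he' p hp
    obtain ⟨l, hl1, hl2, hl3⟩ := h p hp
    obtain ⟨l', hl'1, hl'2, hl'3⟩ := h' e' he'
    obtain ⟨l₁, l₂, rfl, hl₁⟩ := mem_visit (hl1 ▸ he : e ∈ visit p l)
    have n1 : next e (e'.1 - e.1, e'.2) = e' := by simp [next]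
    have n2 : next e' (e.1 - e'.1, e.2) = e := by simp [next]
    -- An excursion is spliced in at `e`: jump to `e'`, run through the closed walk of `B'`, jump
    -- back and resume. The two jumps account for the square.
    refine ⟨l₁ ++ (e'.1 - e.1, e'.2) :: (l' ++ (e.1 - e'.1, e.2) :: l₂), ?_, ?_, ?_⟩
    · have hmem : e' ∈ visit e' l' := hl'1 ▸ he'
      have hmem' : e ∈ B := he
      rw [visit_append, hl₁] at hl1
      rw [visit_append, hl₁]
      simp only [visit, n1, visit_append, hl'2, n2, hl'1]
      have hv : e ∈ visit e l₂ := by cases l₂ <;> simp [visit]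
      rw [← hl1]
      ext x
      simp only [Finset.mem_union, Finset.mem_insert]
      constructor
      · rintro (h | rfl | h | rfl | h) <;> tauto
      · tauto
    · rw [endpt_append, hl₁, endpt_cons, n1, endpt_append, hl'2, endpt_cons, n2]
      rwa [endpt_append, hl₁] at hl2
    · simp only [walkWeight_append, walkWeight_cons] at hl3 ⊢
      have s1 : stepWeight η (e'.1 - e.1, e'.2) = η / (1 + (edist e e' : ℝ)) ^ (d + 1) := by
        unfold stepWeight edist
        rw [nrm_sub_comm]
      have s2 : stepWeight η (e.1 - e'.1, e.2) = η / (1 + (edist e e' : ℝ)) ^ (d + 1) := rfl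
      rw [s1, s2]
      set θ := η / (1 + (edist e e' : ℝ)) ^ (d + 1)
      calc c * c' * θ ^ 2 ≤ (walkWeight η l₁ * walkWeight η l₂) * walkWeight η l' * θ ^ 2 := by
            gcongr
            exact mul_nonneg (walkWeight_pos hη _).le (walkWeight_pos hη _).le
        _ = _ := by ring
  intro p hp
  rcases Finset.mem_union.1 hp with hp | hp
  · exact key hc hc' h h' he he' p hp
  · obtain ⟨l, h1, h2, h3⟩ := key hc' hc h' h he' he p hp
    refine ⟨l, by rw [h1, Finset.union_comm], h2, ?_⟩
    rw [edist_comm, mul_comm c c']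
    exact h3

/-- The part of the walk from `e` to `f` still has weight at least `c`, which by `walkWeight_mul_le`
limits its displacement. So a short contour around a site cannot reach far away. -/
theorem Walkable.edist_le {d : ℕ} {η c : ℝ} (hη0 : 0 < η) (hη : η ≤ 1) (hc : 0 < c)
    {B : Finset (Edge d)} (h : Walkable η c B) {e f : Edge d} (he : e ∈ B) (hf : f ∈ B) :
    (edist e f : ℝ) ≤ c⁻¹ := by
  obtain ⟨l, h1, -, h3⟩ := h e he
  obtain ⟨l₁, l₂, rfl, hl⟩ := mem_visit (h1 ▸ hf : f ∈ visit e l)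
  have h4 := walkWeight_mul_le hη0 hη e l₁
  rw [hl, nrm_sub_comm] at h4
  change walkWeight η l₁ * (1 + (edist e f : ℝ)) ≤ 1 at h4
  rw [walkWeight_append] at h3
  have h5 := walkWeight_le_one hη0 hη l₂
  have h6 := walkWeight_pos hη0 l₁
  have h7 : c ≤ walkWeight η l₁ := by nlinarith
  have h8 : (0 : ℝ) ≤ edist e f := Nat.cast_nonneg _
  rw [← one_div, le_div_iff₀ hc]
  nlinarith

/-! ### Clusters and contours -/

/-- A lower bound `c n` for walk weights of clusters of `n` edges that is compatible with merging
two clusters whose distance is at most `R * m ^ a`, where `m` is the smaller size. -/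
theorem exists_clusterWeight {η : ℝ} (hη0 : 0 < η) (hη : η ≤ 1) (d R a : ℕ) :
    ∃ (c : ℕ → ℝ) (ρ : ℝ), 0 < ρ ∧ ρ ≤ 1 ∧ (∀ n, 1 ≤ n → ρ ^ n ≤ c n) ∧ c 1 ≤ 1 ∧
      ∀ k l D : ℕ, 1 ≤ k → 1 ≤ l → D ≤ R * min k l ^ a →
        c (k + l) ≤ c k * c l * (η / (1 + (D : ℝ)) ^ (d + 1)) ^ 2 := by
  -- The sequence is `2 ^ b / θ * n ^ b * ρ ^ n`. A merge with smaller size `k` multiplies the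
  -- weight by at least `θ / k ^ b`. The polynomial factor pays for it: `(k + l) ^ b ≤ 2 ^ b * l ^
  -- b` leaves the factor `k ^ b` to spare. The choice of `ρ` gives `c 1 = 1`.
  set b := 2 * (a * (d + 1)) with hb
  set θ : ℝ := (η / (R + 1 : ℝ) ^ (d + 1)) ^ 2 with hθ
  have hθ0 : 0 < θ := by positivity
  have hθ1 : θ ≤ 1 := by
    refine pow_le_one₀ (by positivity) ?_
    rw [div_le_one (by positivity)]
    exact hη.trans (one_le_pow₀ (by simp))
  have h2b : (1 : ℝ) ≤ 2 ^ b := one_le_pow₀ (by norm_num)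
  have h1 : 1 ≤ 2 ^ b / θ := by
    rw [le_div_iff₀ hθ0]; linarith
  set ρ : ℝ := θ / 2 ^ b with hρ
  have hρ0 : 0 < ρ := by positivity
  refine ⟨fun n => 2 ^ b / θ * n ^ b * ρ ^ n, ρ, hρ0, ?_, ?_, ?_, ?_⟩
  · rw [div_le_one (by positivity)]; linarith
  · intro n hn
    have : (1 : ℝ) ≤ (n : ℝ) ^ b := one_le_pow₀ (by exact_mod_cast hn)
    have : 1 ≤ 2 ^ b / θ * (n : ℝ) ^ b := one_le_mul_of_one_le_of_one_le h1 this
    exact le_mul_of_one_le_left (by positivity) this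
  · rw [hρ]
    simp only [Nat.cast_one, one_pow, mul_one, pow_one]
    rw [div_mul_div_cancel₀ hθ0.ne', div_self (by positivity)]
  · have main : ∀ k l D : ℕ, 1 ≤ k → k ≤ l → D ≤ R * k ^ a →
        2 ^ b / θ * ((k + l : ℕ) : ℝ) ^ b * ρ ^ (k + l) ≤ (2 ^ b / θ * k ^ b * ρ ^ k) *
          (2 ^ b / θ * l ^ b * ρ ^ l) * (η / (1 + (D : ℝ)) ^ (d + 1)) ^ 2 := by
      intro k l D hk hkl hD
      have hk' : (1 : ℝ) ≤ (k : ℝ) ^ a := one_le_pow₀ (by exact_mod_cast hk)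
      have hkp : (0 : ℝ) < k := by exact_mod_cast hk
      have hD' : 1 + (D : ℝ) ≤ (R + 1) * (k : ℝ) ^ a := by
        have : (D : ℝ) ≤ R * (k : ℝ) ^ a := by exact_mod_cast hD
        linarith
      have hstep : θ / (k : ℝ) ^ b ≤ (η / (1 + (D : ℝ)) ^ (d + 1)) ^ 2 := by
        have e : θ / (k : ℝ) ^ b = (η / ((R + 1) * (k : ℝ) ^ a) ^ (d + 1)) ^ 2 := by
          rw [hθ, mul_pow, ← pow_mul, ← div_div, div_pow (η / _), ← pow_mul, hb]
          congr 2
          ring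
        rw [e]
        gcongr
      have hkl' : ((k + l : ℕ) : ℝ) ^ b ≤ 2 ^ b * (l : ℝ) ^ b := by
        rw [← mul_pow]
        gcongr
        push_cast
        have : (k : ℝ) ≤ l := by exact_mod_cast hkl
        linarith
      calc 2 ^ b / θ * ((k + l : ℕ) : ℝ) ^ b * ρ ^ (k + l)
          ≤ 2 ^ b / θ * (2 ^ b * (l : ℝ) ^ b) * ρ ^ (k + l) := by gcongr
        _ = (2 ^ b / θ * k ^ b * ρ ^ k) * (2 ^ b / θ * l ^ b * ρ ^ l) * (θ / (k : ℝ) ^ b) := by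
            rw [pow_add]
            field_simp
        _ ≤ _ := by gcongr
    intro k l D hk hl hD
    rcases le_total k l with h | h
    · exact main k l D hk h (by rwa [min_eq_left h] at hD)
    · have := main l k D hl h (by rwa [min_eq_right h] at hD)
      rw [add_comm k l, mul_comm (2 ^ b / θ * (k : ℝ) ^ b * ρ ^ k)]
      exact this

/-- Every finite set of edges is a disjoint union of walkable clusters that are far from each
other. -/
theorem exists_clusters {d : ℕ} {η : ℝ} (hη0 : 0 < η) {R a : ℕ} {c : ℕ → ℝ}
    (hc0 : ∀ n, 1 ≤ n → 0 ≤ c n) (hc1 : c 1 ≤ 1)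
    (hc : ∀ k l D : ℕ, 1 ≤ k → 1 ≤ l → D ≤ R * min k l ^ a →
        c (k + l) ≤ c k * c l * (η / (1 + (D : ℝ)) ^ (d + 1)) ^ 2) (E : Finset (Edge d)) :
    ∃ Γ : Finset (Finset (Edge d)), (∀ e, e ∈ E ↔ ∃ B ∈ Γ, e ∈ B) ∧
      (∀ B ∈ Γ, B.Nonempty ∧ Walkable η (c B.card) B) ∧
      (∀ B ∈ Γ, ∀ B' ∈ Γ, B ≠ B' → Disjoint B B') ∧
      ∀ B ∈ Γ, ∀ B' ∈ Γ, B ≠ B' → ∀ e ∈ B, ∀ e' ∈ B', R * min B.card B'.card ^ a < edist e e' := by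
  classical
  -- Take a partition into walkable clusters with the least number of members; singletons show that
  -- one exists. If two clusters were too close, `hc` would make their union walkable, and merging
  -- them would lower the number.
  let Q : ℕ → Prop := fun n => ∃ Γ : Finset (Finset (Edge d)), Γ.card = n ∧
      (∀ e, e ∈ E ↔ ∃ B ∈ Γ, e ∈ B) ∧ (∀ B ∈ Γ, B.Nonempty ∧ Walkable η (c B.card) B) ∧
      (∀ B ∈ Γ, ∀ B' ∈ Γ, B ≠ B' → Disjoint B B')
  have hQ : ∃ n, Q n := by
    refine ⟨_, E.image fun e => {e}, rfl, ?_, ?_, ?_⟩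
    · intro e
      simp only [Finset.mem_image, exists_exists_and_eq_and, Finset.mem_singleton]
      exact ⟨fun h => ⟨e, h, rfl⟩, fun ⟨f, hf, h⟩ => h ▸ hf⟩
    · intro B hB
      obtain ⟨e, -, rfl⟩ := Finset.mem_image.1 hB
      refine ⟨Finset.singleton_nonempty e, (walkable_singleton η e).mono ?_⟩
      simpa using hc1
    · intro B hB B' hB' hne
      obtain ⟨e, -, rfl⟩ := Finset.mem_image.1 hB
      obtain ⟨e', -, rfl⟩ := Finset.mem_image.1 hB'
      rw [Finset.disjoint_singleton]
      rintro rfl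
      exact hne rfl
  obtain ⟨Γ, hcard, hE, hW, hdisj⟩ := Nat.find_spec hQ
  refine ⟨Γ, hE, hW, hdisj, ?_⟩
  intro B hB B' hB' hne e he e' he'
  by_contra hlt
  rw [not_lt] at hlt
  have hBB' : B' ∈ Γ.erase B := Finset.mem_erase.2 ⟨hne.symm, hB'⟩
  have hU : ∀ C ∈ (Γ.erase B).erase B', Disjoint (B ∪ B') C := by
    intro C hC
    rw [Finset.mem_erase, Finset.mem_erase] at hC
    rw [Finset.disjoint_union_left]
    exact ⟨hdisj _ hB _ hC.2.2 hC.2.1.symm, hdisj _ hB' _ hC.2.2 hC.1.symm⟩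
  have hmin : Q (insert (B ∪ B') ((Γ.erase B).erase B')).card := by
    refine ⟨_, rfl, ?_, ?_, ?_⟩
    · intro x
      rw [hE]
      constructor
      · rintro ⟨C, hC, hx⟩
        by_cases h1 : C = B
        · exact ⟨B ∪ B', by simp, by simp [← h1, hx]⟩
        by_cases h2 : C = B'
        · exact ⟨B ∪ B', by simp, by simp [← h2, hx]⟩
        · exact ⟨C, by simp [h1, h2, hC], hx⟩
      · rintro ⟨C, hC, hx⟩
        rw [Finset.mem_insert] at hC
        rcases hC with rfl | hC
        · rcases Finset.mem_union.1 hx with h | h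
          · exact ⟨B, hB, h⟩
          · exact ⟨B', hB', h⟩
        · exact ⟨C, Finset.mem_of_mem_erase (Finset.mem_of_mem_erase hC), hx⟩
    · intro C hC
      rw [Finset.mem_insert] at hC
      rcases hC with rfl | hC
      · refine ⟨(hW B hB).1.mono Finset.subset_union_left, ?_⟩
        rw [Finset.card_union_of_disjoint (hdisj B hB B' hB' hne)]
        have k1 := (hW B hB).1.card_pos
        have k2 := (hW B' hB').1.card_pos
        exact ((hW B hB).2.union hη0 (hc0 _ k1) (hc0 _ k2) (hW B' hB').2 he he').mono
          (hc _ _ _ k1 k2 hlt)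
      · exact hW C (Finset.mem_of_mem_erase (Finset.mem_of_mem_erase hC))
    · intro C hC C' hC' hCC'
      rw [Finset.mem_insert] at hC hC'
      rcases hC with rfl | hC <;> rcases hC' with rfl | hC'
      · exact absurd rfl hCC'
      · exact hU C' hC'
      · exact (hU C hC).symm
      · exact hdisj C (Finset.mem_of_mem_erase (Finset.mem_of_mem_erase hC)) C'
          (Finset.mem_of_mem_erase (Finset.mem_of_mem_erase hC')) hCC'
  have h1 := Nat.find_min' hQ hmin
  have h2 := Finset.card_insert_le (B ∪ B') ((Γ.erase B).erase B')
  have h3 : 0 < (Γ.erase B).card := Finset.card_pos.2 ⟨B', hBB'⟩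
  rw [Finset.card_erase_of_mem hBB'] at h2
  rw [Finset.card_erase_of_mem hB] at h2 h3
  omega

/-- The boundaries of the sets in `Γ` are walkable clusters that are far from each other, and the
indicator function of `P` is the sum mod `2` of those of the members of `Γ`. -/
structure IsContourFamily {d : ℕ} (η : ℝ) (c : ℕ → ℝ) (R a : ℕ) (P : Finset (Site d))
    (Γ : Finset (Finset (Site d))) : Prop where
  nonempty : ∀ A ∈ Γ, (bdry A).Nonempty
  walkable : ∀ A ∈ Γ, Walkable η (c (bdry A).card) (bdry A)
  subset : ∀ A ∈ Γ, bdry A ⊆ bdry P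
  far : ∀ A ∈ Γ, ∀ B ∈ Γ, A ≠ B → ∀ e ∈ bdry A, ∀ f ∈ bdry B,
    R * min (bdry A).card (bdry B).card ^ a < edist e f
  ind_eq : ∀ x, ind P x = ∑ A ∈ Γ, ind A x

/-- Edges of one plaquette are at distance at most 2, and since `R ≥ 2` different clusters are
farther apart. A plaquette therefore meets at most one cluster, each cluster inherits the parity
condition from `bdry P`, and `exists_bdry_eq` fills it. -/
theorem exists_isContourFamily {d : ℕ} (hd : 2 ≤ d) {η : ℝ} (hη0 : 0 < η) {R a : ℕ} (hR : 2 ≤ R)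
    {c : ℕ → ℝ} (hc0 : ∀ n, 1 ≤ n → 0 ≤ c n) (hc1 : c 1 ≤ 1)
    (hc : ∀ k l D : ℕ, 1 ≤ k → 1 ≤ l → D ≤ R * min k l ^ a →
        c (k + l) ≤ c k * c l * (η / (1 + (D : ℝ)) ^ (d + 1)) ^ 2) (P : Finset (Site d)) :
    ∃ Γ, IsContourFamily η c R a P Γ := by
  classical
  obtain ⟨Γ, hE, hW, hdisj, hfar⟩ := exists_clusters hη0 hc0 hc1 hc (bdry P)
  have hclosed : ∀ B ∈ Γ, ∃ A : Finset (Site d), bdry A = B := by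
    intro B hB
    have hnear : ∀ e ∈ B, ∀ f ∈ bdry P, edist e f ≤ 2 → f ∈ B := by
      intro e he f hf hef
      obtain ⟨B', hB', hf'⟩ := (hE f).1 hf
      by_cases h : B = B'
      · exact h ▸ hf'
      · have h1 := hfar B hB B' hB' h e he f hf'
        have h2 : 0 < min B.card B'.card ^ a :=
          Nat.pow_pos (lt_min (hW B hB).1.card_pos (hW B' hB').1.card_pos)
        have := Nat.le_mul_of_pos_right R h2
        omega
    refine exists_bdry_eq hd B fun x i j _ => ?_
    let pl : Finset (Edge d) := {(x, i), (x + unit i, j), (x, j), (x + unit j, i)}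
    have hpl : ∀ e ∈ pl, ∀ f ∈ pl, edist e f ≤ 2 := by
      have h3 : nrm (unit i - unit j : Site d) ≤ 2 := by
        have := nrm_add_le (unit i) (-unit j : Site d)
        rw [nrm_neg, nrm_unit, nrm_unit, ← sub_eq_add_neg] at this
        exact this
      have h4 : nrm (unit j - unit i : Site d) ≤ 2 := by rwa [nrm_sub_comm]
      simp only [pl, Finset.mem_insert, Finset.mem_singleton]
      rintro e (rfl | rfl | rfl | rfl) f (rfl | rfl | rfl | rfl) <;> simp [edist, h3, h4]
    by_cases hex : ∃ e ∈ pl, e ∈ B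
    · obtain ⟨e, hepl, heB⟩ := hex
      have hiff : ∀ f ∈ pl, (f ∈ B ↔ f ∈ bdry P) := fun f hf =>
        ⟨fun h => (hE f).2 ⟨B, hB, h⟩, fun h => hnear e heB f h (hpl e hepl f hf)⟩
      have := bdry_plaquette P x i j
      rwa [← if_congr (hiff (x, i) (by simp [pl])) rfl rfl,
        ← if_congr (hiff (x + unit i, j) (by simp [pl])) rfl rfl,
        ← if_congr (hiff (x, j) (by simp [pl])) rfl rfl,
        ← if_congr (hiff (x + unit j, i) (by simp [pl])) rfl rfl] at this
    · push Not at hex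
      rw [if_neg (hex _ (by simp [pl])), if_neg (hex _ (by simp [pl])),
        if_neg (hex _ (by simp [pl])), if_neg (hex _ (by simp [pl]))]
  choose! fill hfill using hclosed
  have hb : ∀ A ∈ Γ.image fill, bdry A ∈ Γ ∧ fill (bdry A) = A := by
    intro A hA
    obtain ⟨B, hB, rfl⟩ := Finset.mem_image.1 hA
    rw [hfill B hB]
    exact ⟨hB, rfl⟩
  have hne : ∀ A ∈ Γ.image fill, ∀ B ∈ Γ.image fill, A ≠ B → bdry A ≠ bdry B := by
    intro A hA B hB hAB h
    exact hAB (by rw [← (hb A hA).2, h, (hb B hB).2])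
  refine ⟨Γ.image fill, fun A hA => (hW _ (hb A hA).1).1, fun A hA => (hW _ (hb A hA).1).2,
    fun A hA e he => (hE e).2 ⟨_, (hb A hA).1, he⟩,
    fun A hA B hB hAB => hfar _ (hb A hA).1 _ (hb B hB).1 (hne A hA B hB hAB), ?_⟩
  refine ind_eq_sum ⟨0, by omega⟩ (Γ.image fill) (fun A => A) P ?_ ?_
  · intro e
    rw [hE]
    constructor
    · rintro ⟨B, hB, he⟩
      exact ⟨fill B, Finset.mem_image_of_mem _ hB, by rwa [hfill B hB]⟩
    · rintro ⟨A, hA, he⟩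
      exact ⟨_, (hb A hA).1, he⟩
  · intro A hA B hB hAB
    exact hdisj _ (hb A hA).1 _ (hb B hB).1 (hne A hA B hB hAB)

theorem IsContourFamily.exists_mem {d : ℕ} {η : ℝ} {c : ℕ → ℝ} {R a : ℕ} {P : Finset (Site d)}
    {Γ : Finset (Finset (Site d))} (h : IsContourFamily η c R a P Γ) {x : Site d} (hx : x ∈ P) :
    ∃ A ∈ Γ, x ∈ A := by
  by_contra hc
  push Not at hc
  have := h.ind_eq x
  rw [Finset.sum_eq_zero fun A hA => by simp [ind, hc A hA]] at this
  simp [ind, hx] at this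

/-- Parity: the sum of the indicators is the same at `x` and `y` while the summand of `A` changes,
so another summand changes too. -/
theorem IsContourFamily.exists_separates {d : ℕ} {η : ℝ} {c : ℕ → ℝ} {R a : ℕ}
    {P : Finset (Site d)} {Γ : Finset (Finset (Site d))} (h : IsContourFamily η c R a P Γ)
    {A : Finset (Site d)} (hA : A ∈ Γ) {x y : Site d} (hxy : x ∈ P ↔ y ∈ P) (hx : x ∈ A)
    (hy : y ∉ A) : ∃ B ∈ Γ, B ≠ A ∧ ¬ (x ∈ B ↔ y ∈ B) := by
  classical
  by_contra hc
  push Not at hc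
  have h1 := h.ind_eq x
  have h2 := h.ind_eq y
  rw [ind_eq_ind.2 hxy, h2, ← Finset.add_sum_erase _ _ hA, ← Finset.add_sum_erase _ _ hA,
    Finset.sum_congr rfl fun B hB => (ind_eq_ind.2 (hc B (Finset.mem_of_mem_erase hB)
      (Finset.ne_of_mem_erase hB)) : ind B x = ind B y)] at h1
  have := add_right_cancel h1
  simp [ind, hx, hy] at this

/-! ### Interaction between sets, and between contours -/

open Classical in
/-- The total coupling of the ordered pairs that satisfy `r`. -/
noncomputable def pairSum {d : ℕ} (J α : ℝ) (r : Site d → Site d → Prop) : ℝ≥0∞ :=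
  ∑' x, ∑' y, if r x y then ENNReal.ofReal (coupling J α x y) else 0

theorem coupling_nonneg {d : ℕ} {J α : ℝ} (hJ : 0 ≤ J) (x y : Site d) : 0 ≤ coupling J α x y := by
  unfold coupling
  split_ifs
  · rfl
  · rw [l1_eq_nrm]; positivity

theorem coupling_comm {d : ℕ} (J α : ℝ) (x y : Site d) : coupling J α x y = coupling J α y x := by
  unfold coupling
  rw [l1_eq_nrm, l1_eq_nrm, nrm_sub_comm]
  simp only [eq_comm]

theorem pairSum_comm {d : ℕ} (J α : ℝ) (r : Site d → Site d → Prop) :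
    pairSum J α r = pairSum J α fun x y => r y x := by
  unfold pairSum
  rw [ENNReal.tsum_comm]
  refine tsum_congr fun x => tsum_congr fun y => ?_
  rw [coupling_comm]

theorem pairSum_le_sum {d : ℕ} {ι : Type*} (J α : ℝ) (s : Finset ι) (r : Site d → Site d → Prop)
    (q : ι → Site d → Site d → Prop) (h : ∀ x y, r x y → ∃ i ∈ s, q i x y) :
    pairSum J α r ≤ ∑ i ∈ s, pairSum J α (q i) := by
  classical
  unfold pairSum
  rw [← Summable.tsum_finsetSum fun _ _ => ENNReal.summable]
  refine ENNReal.tsum_le_tsum fun x => ?_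
  rw [← Summable.tsum_finsetSum fun _ _ => ENNReal.summable]
  refine ENNReal.tsum_le_tsum fun y => ?_
  split_ifs with hr
  · obtain ⟨i, hi, hq⟩ := h x y hr
    refine le_trans ?_ (Finset.single_le_sum (fun _ _ => zero_le) hi)
    rw [if_pos hq]
  · exact zero_le

theorem pairSum_le_add {d : ℕ} (J α : ℝ) (r q₁ q₂ : Site d → Site d → Prop)
    (h : ∀ x y, r x y → q₁ x y ∨ q₂ x y) :
    pairSum J α r ≤ pairSum J α q₁ + pairSum J α q₂ := by
  have := pairSum_le_sum J α Finset.univ r (fun b : Bool => if b then q₁ else q₂)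
    (fun x y hr => by
      rcases h x y hr with h | h
      · exact ⟨true, by simp, by simpa⟩
      · exact ⟨false, by simp, by simpa⟩)
  simpa using this

/-- A shift no longer than `|x - y|` at most doubles the distance. -/
theorem coupling_le_shift {d : ℕ} {J α : ℝ} (hJ : 0 ≤ J) (hα : 0 ≤ α) {x y v : Site d}
    (hv : nrm v ≤ nrm (x - y)) (hy : x + v ≠ y) :
    coupling J α x y ≤ 2 ^ α * coupling J α (x + v) y := by
  unfold coupling
  rw [if_neg hy]
  split_ifs with h
  · rw [l1_eq_nrm]
    positivity
  · rw [l1_eq_nrm, l1_eq_nrm]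
    have h1 : 0 < nrm (x - y) := nrm_pos (sub_ne_zero.2 h)
    have h2 : 0 < nrm (x + v - y) := nrm_pos (sub_ne_zero.2 hy)
    have h3 : nrm (x + v - y) ≤ 2 * nrm (x - y) := by
      have := nrm_add_le (x - y) v
      rw [sub_add_eq_add_sub] at this
      omega
    have h1' : (0 : ℝ) < nrm (x - y) := by exact_mod_cast h1
    have h2' : (0 : ℝ) < nrm (x + v - y) := by exact_mod_cast h2
    have h3' : (nrm (x + v - y) : ℝ) ≤ 2 * nrm (x - y) := by exact_mod_cast h3
    rw [mul_div_assoc', div_le_div_iff₀ (by positivity) (by positivity)]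
    calc J * (nrm (x + v - y) : ℝ) ^ α ≤ J * (2 * nrm (x - y) : ℝ) ^ α := by gcongr
      _ = 2 ^ α * J * (nrm (x - y) : ℝ) ^ α := by
        rw [Real.mul_rpow (by norm_num) h1'.le]; ring

/-- If `U` is so sparse in `S` that it can be spread out over `r` translates inside `S` with
multiplicity at most `q`, then its interaction with `T` is at most `2 ^ α * q / r` times that
of `S`. -/
theorem pairSum_sparse_le {d : ℕ} {J α : ℝ} (hJ : 0 ≤ J) (hα : 0 ≤ α) (i : Fin d)
    (S U T : Set (Site d)) (r q : ℕ) (hST : Disjoint S T)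
    (h1 : ∀ x ∈ S, x ∈ U → ∀ k < r, x + (k : ℤ) • unit i ∈ S)
    (h2 : ∀ x ∈ S, x ∈ U → ∀ y ∈ T, r ≤ nrm (x - y))
    (h3 : ∀ x, ∀ s : Finset ℕ, (∀ k ∈ s, k < r ∧ x - (k : ℤ) • unit i ∈ U) → s.card ≤ q) :
    r * pairSum J α (fun x y => (x ∈ S ∧ x ∈ U) ∧ y ∈ T) ≤
      ENNReal.ofReal (2 ^ α) * q * pairSum J α fun x y => x ∈ S ∧ y ∈ T := by
  classical
  -- Each site `x` of `U` is replaced by its `k`-th translate, which is still in `S`, at the price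
  -- of `2 ^ α`. Summed over `k < r`, no site is used more than `q` times.
  have hk : ∀ k ∈ Finset.range r, pairSum J α (fun x y => (x ∈ S ∧ x ∈ U) ∧ y ∈ T) ≤
      ∑' x, (if x - (k : ℤ) • unit i ∈ U then 1 else 0) * (ENNReal.ofReal (2 ^ α) * ∑' y,
        if x ∈ S ∧ y ∈ T then ENNReal.ofReal (coupling J α x y) else 0) := by
    intro k hk
    rw [Finset.mem_range] at hk
    let G : Site d → ℝ≥0∞ := fun x => (if x - (k : ℤ) • unit i ∈ U then 1 else 0) *
      (ENNReal.ofReal (2 ^ α) * ∑' y,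
        if x ∈ S ∧ y ∈ T then ENNReal.ofReal (coupling J α x y) else 0)
    change _ ≤ ∑' x, G x
    rw [← (Equiv.addRight ((k : ℤ) • unit i : Site d)).tsum_eq G]
    refine ENNReal.tsum_le_tsum fun x => ?_
    change _ ≤ G (x + (k : ℤ) • unit i)
    simp only [G, add_sub_cancel_right]
    rw [← ENNReal.tsum_mul_left, ← ENNReal.tsum_mul_left]
    refine ENNReal.tsum_le_tsum fun y => ?_
    split_ifs with hx hU hS hS hU
    · rw [one_mul, ← ENNReal.ofReal_mul (by positivity)]
      refine ENNReal.ofReal_le_ofReal (coupling_le_shift hJ hα ?_ ?_)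
      · rw [nrm_smul_unit, Int.natAbs_natCast]
        exact hk.le.trans (h2 x hx.1.1 hx.1.2 y hx.2)
      · intro h
        rw [h] at hS
        exact Set.disjoint_left.1 hST hS.1 hS.2
    · exact absurd ⟨h1 x hx.1.1 hx.1.2 k hk, hx.2⟩ hS
    · exact absurd hx.1.2 hU
    · exact absurd hx.1.2 hU
    all_goals exact zero_le
  calc (r : ℝ≥0∞) * pairSum J α (fun x y => (x ∈ S ∧ x ∈ U) ∧ y ∈ T)
      = ∑ _k ∈ Finset.range r, pairSum J α (fun x y => (x ∈ S ∧ x ∈ U) ∧ y ∈ T) := by simp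
    _ ≤ _ := Finset.sum_le_sum hk
    _ = ∑' x, (∑ k ∈ Finset.range r, if x - (k : ℤ) • unit i ∈ U then 1 else 0) *
          (ENNReal.ofReal (2 ^ α) * ∑' y,
            if x ∈ S ∧ y ∈ T then ENNReal.ofReal (coupling J α x y) else 0) := by
        rw [← Summable.tsum_finsetSum fun _ _ => ENNReal.summable]
        exact tsum_congr fun x => (Finset.sum_mul _ _ _).symm
    _ ≤ ∑' x, (q : ℝ≥0∞) * (ENNReal.ofReal (2 ^ α) * ∑' y,
            if x ∈ S ∧ y ∈ T then ENNReal.ofReal (coupling J α x y) else 0) := by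
        refine ENNReal.tsum_le_tsum fun x => ?_
        gcongr
        rw [Finset.sum_boole]
        exact_mod_cast h3 x _ fun k hk => by simpa using hk
    _ = _ := by
        rw [ENNReal.tsum_mul_left, ENNReal.tsum_mul_left, ← mul_assoc, mul_comm (q : ℝ≥0∞)]
        unfold pairSum
        congr!

/-- The interaction of `A` with its complement is at least `J` times the number of boundary
edges. -/
theorem card_bdry_le_pairSum {d : ℕ} {J : ℝ} (α : ℝ) (A : Finset (Site d)) :
    ENNReal.ofReal J * (bdry A).card ≤ pairSum J α fun x y => x ∈ A ∧ y ∉ A := by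
  classical
  -- Each boundary edge, oriented from the inside to the outside, is a separate pair with coupling
  -- exactly `J`.
  let f : Edge d → Site d × Site d := fun e =>
    if e.1 ∈ A then (e.1, e.1 + unit e.2) else (e.1 + unit e.2, e.1)
  have hunit : ∀ i j : Fin d, (unit i : Site d) = unit j → i = j := by
    intro i j h
    by_contra hij
    have := congrFun h i
    simp [unit_ne hij] at this
  have hunit' : ∀ i j : Fin d, (unit i : Site d) + unit j ≠ 0 := by
    intro i j h
    have := congrFun h i
    by_cases hij : i = j
    · simp [hij] at this
    · simp [unit_ne hij] at this
  have hinj : Set.InjOn f (bdry A) := by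
    rintro ⟨x, i⟩ hx ⟨y, j⟩ hy hxy
    simp only [f] at hxy
    split_ifs at hxy with h1 h2 h2
    · simp only [Prod.mk.injEq] at hxy
      obtain ⟨rfl, h⟩ := hxy
      rw [hunit i j (add_left_cancel h)]
    · simp only [Prod.mk.injEq] at hxy
      obtain ⟨rfl, h⟩ := hxy
      rw [add_assoc, add_eq_left] at h
      exact absurd h (hunit' _ _)
    · simp only [Prod.mk.injEq] at hxy
      obtain ⟨rfl, h⟩ := hxy
      rw [add_assoc, left_eq_add] at h
      exact absurd h (hunit' _ _)
    · simp only [Prod.mk.injEq] at hxy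
      obtain ⟨h, rfl⟩ := hxy
      rw [hunit i j (add_left_cancel h)]
  unfold pairSum
  rw [← ENNReal.tsum_prod]
  refine le_trans ?_ (ENNReal.sum_le_tsum ((bdry A).image f))
  rw [Finset.sum_image hinj, mul_comm, ← nsmul_eq_mul, ← Finset.sum_const]
  refine Finset.sum_le_sum fun e he => ?_
  have hne : e.1 ≠ e.1 + unit e.2 := by
    rw [Ne, left_eq_add]
    intro h
    have := congrFun h e.2
    simp at this
  rw [mem_bdry] at he
  have hu0 : (unit e.2 : Site d) ≠ 0 := by simpa using hne
  by_cases h : e.1 ∈ A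
  · have h2 : e.1 + unit e.2 ∉ A := by tauto
    simp [f, h, h2, coupling, l1_eq_nrm, hu0]
  · have h2 : e.1 + unit e.2 ∈ A := by tauto
    simp [f, h, h2, coupling, l1_eq_nrm, hu0]

theorem coupling_le {d : ℕ} {J α : ℝ} (hJ : 0 ≤ J) (hα : 0 ≤ α) (x y : Site d) :
    coupling J α x y ≤ J * 2 ^ α * (1 + (nrm (x - y) : ℝ)) ^ (-α) := by
  unfold coupling
  split_ifs with h
  · positivity
  · have h1 : (1 : ℝ) ≤ nrm (x - y) := by exact_mod_cast nrm_pos (sub_ne_zero.2 h)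
    rw [l1_eq_nrm, Real.rpow_neg (by positivity), ← div_eq_mul_inv,
      div_le_div_iff₀ (by positivity) (by positivity), mul_assoc, ← Real.mul_rpow (by norm_num)
      (by positivity)]
    gcongr
    linarith

theorem tsum_nrm_sub {d : ℕ} (g : ℕ → ℝ≥0∞) (x : Site d) :
    ∑' y, g (nrm (x - y)) = ∑' v : Site d, g (nrm v) :=
  (Equiv.subLeft x).tsum_eq fun v => g (nrm v)

/-- With `d < p < α`, the power `-p` of the distance is summable and the remaining power `-(α - p)`
is at most `r ^ (-(α - p))`. -/
theorem pairSum_far_le {d : ℕ} (hd : 0 < d) {J α : ℝ} (hJ : 0 < J) (hα : (d : ℝ) < α) :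
    ∃ κ C : ℝ, 0 < κ ∧ 0 < C ∧ ∀ (A : Finset (Site d)) (r : ℕ), 1 ≤ r →
      pairSum J α (fun x y => x ∈ A ∧ r < nrm (x - y)) ≤
        A.card * ENNReal.ofReal (C * (r : ℝ) ^ (-κ)) := by
  classical
  obtain ⟨p, hp1, hp2⟩ := exists_between hα
  have hp0 : 0 < p := lt_of_le_of_lt (Nat.cast_nonneg d) hp1
  have hs := summable_nrm_rpow hd hp1
  set T := ∑' v : Site d, (1 + (nrm v : ℝ)) ^ (-p) with hT
  have hT0 : 0 ≤ T := tsum_nonneg fun v => by positivity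
  refine ⟨α - p, (J * 2 ^ α) * (T + 1), by linarith, by positivity, ?_⟩
  · intro A r hr
    have hr' : (1 : ℝ) ≤ r := by exact_mod_cast hr
    have hx : ∀ x ∈ A, (∑' y, if x ∈ A ∧ r < nrm (x - y) then ENNReal.ofReal (coupling J α x y)
        else 0) ≤ ENNReal.ofReal ((J * 2 ^ α) * (T + 1) * (r : ℝ) ^ (-(α - p))) := by
      intro x _
      calc _ ≤ ∑' y, ENNReal.ofReal (J * 2 ^ α * (r : ℝ) ^ (-(α - p))) *
            ENNReal.ofReal ((1 + (nrm (x - y) : ℝ)) ^ (-p)) := by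
            refine ENNReal.tsum_le_tsum fun y => ?_
            split_ifs with h
            · rw [← ENNReal.ofReal_mul (by positivity)]
              refine ENNReal.ofReal_le_ofReal ((coupling_le hJ.le (by linarith) x y).trans ?_)
              have h1 : (r : ℝ) ≤ 1 + nrm (x - y) := by
                have : (r : ℝ) ≤ nrm (x - y) := by exact_mod_cast h.2.le
                linarith
              have e : -α = -(α - p) + -p := by ring
              rw [e, Real.rpow_add (by positivity), ← mul_assoc]
              gcongr ?_ * _
              gcongr ?_ * ?_
              exact Real.rpow_le_rpow_of_nonpos (by positivity) h1 (by linarith)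
            · exact zero_le
        _ = ENNReal.ofReal (J * 2 ^ α * (r : ℝ) ^ (-(α - p))) * ENNReal.ofReal T := by
            rw [ENNReal.tsum_mul_left,
              tsum_nrm_sub (fun n => ENNReal.ofReal ((1 + (n : ℝ)) ^ (-p))) x, hT,
              ENNReal.ofReal_tsum_of_nonneg (fun v => by positivity) hs]
        _ ≤ _ := by
            rw [← ENNReal.ofReal_mul (by positivity)]
            refine ENNReal.ofReal_le_ofReal ?_
            rw [mul_right_comm]
            gcongr
            linarith
    unfold pairSum
    rw [tsum_eq_sum (s := A), ← nsmul_eq_mul, ← Finset.sum_const]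
    · refine Finset.sum_le_sum fun x hxA => ?_
      refine le_of_eq_of_le ?_ (hx x hxA)
      congr!
    · intro x hxA
      simp [hxA]

theorem sum_inv_sq_le (n : ℕ) : ∑ m ∈ Finset.Icc 1 n, 1 / (m : ℝ) ^ 2 ≤ 2 - 1 / (n : ℝ) := by
  induction n with
  | zero => simp
  | succ n ih =>
    rw [Finset.sum_Icc_succ_top (by omega)]
    rcases Nat.eq_zero_or_pos n with rfl | hn
    · norm_num
    · have hn' : (0 : ℝ) < n := by exact_mod_cast hn
      have : 1 / ((n + 1 : ℕ) : ℝ) ^ 2 ≤ 1 / n - 1 / (n + 1 : ℕ) := by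
        push_cast
        rw [div_sub_div _ _ hn'.ne' (by positivity), div_le_div_iff₀ (by positivity) (by positivity)]
        nlinarith
      linarith

/-- Removing one contour: the pairs across the boundary of `A` that agree in `P` carry at most one
eighth of the total interaction across the boundary of `A`. -/
theorem exists_cross_le {d : ℕ} (hd : 2 ≤ d) {J α : ℝ} (hJ : 0 < J) (hα : (d : ℝ) < α) :
    ∃ R a : ℕ, 2 ≤ R ∧ ∀ (η : ℝ) (c : ℕ → ℝ) (P : Finset (Site d)) (Γ : Finset (Finset (Site d))),
      IsContourFamily η c R a P Γ → ∀ A ∈ Γ,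
        8 * pairSum J α (fun x y => x ∈ A ∧ y ∉ A ∧ (x ∈ P ↔ y ∈ P)) ≤
          pairSum J α fun x y => x ∈ A ∧ y ∉ A := by
  classical
  obtain ⟨κ, C, hκ, hC, htail⟩ := pairSum_far_le (by omega : 0 < d) hJ hα
  have hα0 : 0 ≤ α := (Nat.cast_nonneg d).trans hα.le
  let i₀ : Fin d := ⟨0, by omega⟩
  -- `a ≥ 4` turns the multiplicity `m ^ 2` over the range `m ^ a` into the summable `1 / m ^ 2`; `a
  -- * κ ≥ 2` lets the tail `(n ^ a) ^ (-κ)` beat `A.card ≤ n ^ 2`. Then `M` is large enough for `2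
  -- ^ α / M ≤ 1 / 64` and `C / M ^ κ ≤ J / 16`.
  obtain ⟨a₀, ha₀⟩ := exists_nat_ge (2 / κ)
  set a := max a₀ 4 with ha
  have ha4 : 4 ≤ a := le_max_right _ _
  have haκ : 2 ≤ a * κ := by
    rw [← div_le_iff₀ hκ]
    exact ha₀.trans (by exact_mod_cast le_max_left _ _)
  obtain ⟨M₁, hM₁⟩ := exists_nat_ge (64 * (2 : ℝ) ^ α)
  obtain ⟨M₂, hM₂⟩ := exists_nat_ge ((16 * C / J) ^ (1 / κ))
  set M := max (max M₁ M₂) 1 with hM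
  have hM1 : 1 ≤ M := le_max_right _ _
  have hMα : 64 * (2 : ℝ) ^ α ≤ M :=
    hM₁.trans (by exact_mod_cast (le_max_left _ _).trans (le_max_left _ _))
  have hMκ : 16 * C / J ≤ (M : ℝ) ^ κ := by
    have h1 : (16 * C / J) ^ (1 / κ) ≤ M :=
      hM₂.trans (by exact_mod_cast (le_max_right _ _).trans (le_max_left _ _))
    calc 16 * C / J = ((16 * C / J) ^ (1 / κ)) ^ κ := by
          rw [← Real.rpow_mul (by positivity), one_div_mul_cancel hκ.ne', Real.rpow_one]
      _ ≤ _ := by gcongr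
  refine ⟨8 * M, a, by omega, ?_⟩
  intro η c P Γ hΓ A hA
  set n := (bdry A).card with hn
  have hn1 : 1 ≤ n := (hΓ.nonempty A hA).card_pos
  set r : ℕ → ℕ := fun m => M * m ^ a with hr
  have hr_sq : ∀ m, 1 ≤ m → m ^ 2 ≤ r m := fun m hm => by
    calc m ^ 2 ≤ m ^ a := Nat.pow_le_pow_right hm (by omega)
      _ ≤ M * m ^ a := Nat.le_mul_of_pos_left _ hM1
  have hr_one : ∀ m, 1 ≤ m → 1 ≤ r m := fun m hm =>
    (Nat.one_le_pow 2 m hm).trans (hr_sq m hm)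
  have hfar : ∀ B ∈ Γ, ∀ B' ∈ Γ, B ≠ B' → ∀ e ∈ bdry B, ∀ f ∈ bdry B',
      8 * r (min (bdry B).card (bdry B').card) < edist e f := by
    intro B hB B' hB' hne e he f hf
    have := hΓ.far B hB B' hB' hne e he f hf
    rwa [mul_assoc] at this
  have hdist : ∀ (e f : Edge d) (z : Site d), edist e f ≤ nrm (e.1 - z) + nrm (f.1 - z) := by
    intro e f z
    rw [nrm_sub_comm f.1 z]
    exact nrm_sub_le _ _ _
  let U : ℕ → Set (Site d) := fun m => {x | ∃ B ∈ Γ, B ≠ A ∧ (bdry B).card = m ∧ x ∈ B}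
  have hUone : ∀ m x, x ∈ U m → 1 ≤ m := by
    rintro m x ⟨B, hB, -, rfl, -⟩
    exact (hΓ.nonempty B hB).card_pos
  -- points of a smaller contour are deep inside `A` or deep outside
  have hdeep : ∀ m ≤ n, ∀ z ∈ U m, ∀ w, nrm (z - w) ≤ r m → (z ∈ A ↔ w ∈ A) := by
    rintro m hm z ⟨B, hB, hne, hBm, hz⟩ w hzw
    by_contra hsep
    have hm1 : 1 ≤ m := hUone m z ⟨B, hB, hne, hBm, hz⟩
    obtain ⟨e, he, he2⟩ := exists_mem_bdry_of_separates hsep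
    obtain ⟨f, hf, hf2⟩ := exists_mem_bdry_near hd hz
    have h1 := hfar A hA B hB hne.symm e he f hf
    rw [hBm, ← hn, min_eq_right hm] at h1
    have h2 := hdist e f z
    have h3 := hr_sq m hm1
    rw [hBm] at hf2
    omega
  -- Two different contours of length `m` are too far apart for both to contain sites on a segment
  -- of length `r m`. Hence the sites counted lie in one set `B`, which has at most `m ^ 2`
  -- elements.
  have hmult : ∀ m x, ∀ s : Finset ℕ, (∀ k ∈ s, k < r m ∧ x - (k : ℤ) • unit i₀ ∈ U m) →
      s.card ≤ m ^ 2 := by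
    intro m x s hs
    rcases s.eq_empty_or_nonempty with rfl | ⟨k₀, hk₀⟩
    · simp
    obtain ⟨hk₀r, B, hB, hBA, hBm, hBx⟩ := hs k₀ hk₀
    have hm1 : 1 ≤ m := hUone m _ (hs k₀ hk₀).2
    have hsB : ∀ k ∈ s, x - (k : ℤ) • unit i₀ ∈ B := by
      intro k hk
      obtain ⟨hkr, B', hB', hBA', hBm', hBx'⟩ := hs k hk
      by_cases h : B = B'
      · rwa [h]
      exfalso
      obtain ⟨e, he, he2⟩ := exists_mem_bdry_near hd hBx
      obtain ⟨f, hf, hf2⟩ := exists_mem_bdry_near hd hBx'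
      have h1 := hfar B hB B' hB' h e he f hf
      rw [hBm, hBm', min_self] at h1
      have h2 := hdist e f x
      have h3 : ∀ (g : Edge d) (k : ℕ), nrm (g.1 - x) ≤ nrm (g.1 - (x - (k : ℤ) • unit i₀)) + k := by
        intro g k
        have := nrm_sub_le g.1 (x - (k : ℤ) • unit i₀) x
        rwa [sub_sub_cancel_left, nrm_neg, nrm_smul_unit, Int.natAbs_natCast] at this
      have h4 := h3 e k₀
      have h5 := h3 f k
      have h6 := hr_sq m hm1
      rw [hBm] at he2
      rw [hBm'] at hf2
      omega
    rw [← hBm]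
    refine le_trans ?_ (card_le_sq_card_bdry hd B)
    refine Finset.card_le_card_of_injOn (fun k : ℕ => x - (k : ℤ) • unit i₀) hsB ?_
    intro k _ l _ h
    have := congrFun h i₀
    simpa using this
  set cut := pairSum J α (fun x y => x ∈ A ∧ y ∉ A) with hcut
  -- contribution of the smaller contours
  have hsmall : ∀ m ∈ Finset.Icc 1 n, ∀ ST : Set (Site d) × Set (Site d),
      (ST = ((A : Set (Site d)), (A : Set (Site d))ᶜ) ∨ ST = ((A : Set (Site d))ᶜ, (A : Set (Site d)))) →
      pairSum J α (fun x y => (x ∈ ST.1 ∧ x ∈ U m) ∧ y ∈ ST.2) ≤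
        ENNReal.ofReal (2 ^ α / M * (1 / (m : ℝ) ^ 2)) * cut := by
    intro m hm ST hST
    rw [Finset.mem_Icc] at hm
    have hm0 : (0 : ℝ) < m := by exact_mod_cast hm.1
    have hM0 : (0 : ℝ) < M := by exact_mod_cast hM1
    have key : (r m : ℝ≥0∞) * pairSum J α (fun x y => (x ∈ ST.1 ∧ x ∈ U m) ∧ y ∈ ST.2) ≤
        ENNReal.ofReal (2 ^ α) * (m ^ 2 : ℕ) * pairSum J α fun x y => x ∈ ST.1 ∧ y ∈ ST.2 := by
      have hshift : ∀ x : Site d, ∀ k < r m, nrm (x - (x + (k : ℤ) • unit i₀)) ≤ r m := by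
        intro x k hk
        rw [sub_add_cancel_left, nrm_neg, nrm_smul_unit, Int.natAbs_natCast]
        exact hk.le
      rcases hST with rfl | rfl
      · refine pairSum_sparse_le hJ.le hα0 i₀ _ _ _ _ _ disjoint_compl_right ?_ ?_ (hmult m)
        · intro x hx hxU k hk
          exact (hdeep m hm.2 x hxU _ (hshift x k hk)).1 hx
        · intro x hx hxU y hy
          by_contra hc
          exact hy ((hdeep m hm.2 x hxU y (by omega)).1 hx)
      · refine pairSum_sparse_le hJ.le hα0 i₀ _ _ _ _ _ disjoint_compl_left ?_ ?_ (hmult m)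
        · intro x hx hxU k hk h
          exact hx ((hdeep m hm.2 x hxU _ (hshift x k hk)).2 h)
        · intro x hx hxU y hy
          by_contra hc
          exact hx ((hdeep m hm.2 x hxU y (by omega)).2 hy)
    have hcutST : pairSum J α (fun x y => x ∈ ST.1 ∧ y ∈ ST.2) = cut := by
      rcases hST with rfl | rfl
      · rfl
      · rw [pairSum_comm, hcut]
        congr 1
        funext x y
        simp [and_comm]
    rw [hcutST] at key
    have hrm : (0 : ℝ) < r m := by exact_mod_cast hr_one m hm.1
    have h1 : pairSum J α (fun x y => (x ∈ ST.1 ∧ x ∈ U m) ∧ y ∈ ST.2) ≤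
        ENNReal.ofReal (2 ^ α) * (m ^ 2 : ℕ) * cut / r m := by
      rw [ENNReal.le_div_iff_mul_le (Or.inl (by exact_mod_cast hrm.ne'))
        (Or.inl (ENNReal.natCast_ne_top _)), mul_comm]
      exact key
    refine h1.trans ?_
    have e : ENNReal.ofReal (2 ^ α) * (m ^ 2 : ℕ) * cut / r m
        = ENNReal.ofReal (2 ^ α * (m ^ 2 : ℕ) / (r m : ℝ)) * cut := by
      rw [ENNReal.ofReal_div_of_pos hrm, ENNReal.ofReal_mul (by positivity), ENNReal.ofReal_natCast,
        ENNReal.ofReal_natCast, ENNReal.mul_div_right_comm]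
    rw [e]
    gcongr
    have h4 : (m : ℝ) ^ 4 ≤ (m : ℝ) ^ a := pow_le_pow_right₀ (by exact_mod_cast hm.1) ha4
    simp only [hr]
    push_cast
    rw [div_mul_div_comm, mul_one, div_le_div_iff₀ (by positivity) (by positivity)]
    calc 2 ^ α * (m : ℝ) ^ 2 * (M * (m : ℝ) ^ 2) = 2 ^ α * (M * (m : ℝ) ^ 4) := by ring
      _ ≤ _ := by gcongr
  -- contribution of the larger contours
  have hlarge : pairSum J α (fun x y => x ∈ A ∧ r n < nrm (x - y)) ≤ ENNReal.ofReal (1 / 16) * cut := by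
    refine (htail A (r n) (hr_one n hn1)).trans ?_
    have hn0 : (1 : ℝ) ≤ n := by exact_mod_cast hn1
    have hM0 : (0 : ℝ) < M := by exact_mod_cast hM1
    have hcard : (A.card : ℝ≥0∞) ≤ ENNReal.ofReal ((n : ℝ) ^ 2) := by
      rw [← Nat.cast_pow, ENNReal.ofReal_natCast]
      exact_mod_cast card_le_sq_card_bdry hd A
    have hcutn : ENNReal.ofReal J ≤ cut := by
      refine le_trans ?_ (card_bdry_le_pairSum α A)
      exact le_mul_of_one_le_right zero_le (by exact_mod_cast hn1)
    calc _ ≤ ENNReal.ofReal ((n : ℝ) ^ 2) * ENNReal.ofReal (C * (r n : ℝ) ^ (-κ)) := by gcongr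
      _ = ENNReal.ofReal ((n : ℝ) ^ 2 * (C * (r n : ℝ) ^ (-κ))) :=
          (ENNReal.ofReal_mul (by positivity)).symm
      _ ≤ ENNReal.ofReal (1 / 16 * J) := by
          refine ENNReal.ofReal_le_ofReal ?_
          have h1 : (n : ℝ) ^ 2 ≤ ((n : ℝ) ^ a) ^ κ := by
            rw [← Real.rpow_natCast n a, ← Real.rpow_mul (by positivity), ← Real.rpow_two]
            exact Real.rpow_le_rpow_of_exponent_le hn0 haκ
          simp only [hr]
          push_cast
          rw [Real.mul_rpow (by positivity) (by positivity), Real.rpow_neg (by positivity),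
            Real.rpow_neg (by positivity), div_le_iff₀ hJ] at *
          have hMk : (0 : ℝ) < (M : ℝ) ^ κ := by positivity
          have hnk : (0 : ℝ) < ((n : ℝ) ^ a) ^ κ := by positivity
          have e : (n : ℝ) ^ 2 * (C * (((M : ℝ) ^ κ)⁻¹ * (((n : ℝ) ^ a) ^ κ)⁻¹))
              = (n : ℝ) ^ 2 / ((n : ℝ) ^ a) ^ κ * (C / (M : ℝ) ^ κ) := by
            field_simp
          rw [e]
          calc _ ≤ 1 * (1 / 16 * J) := by
                gcongr
                · exact (div_le_one hnk).2 h1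
                · rw [div_le_iff₀ hMk]; linarith
            _ = _ := one_mul _
      _ = ENNReal.ofReal (1 / 16) * ENNReal.ofReal J := ENNReal.ofReal_mul (by norm_num)
      _ ≤ _ := by gcongr
  -- all together
  have hsplit : pairSum J α (fun x y => x ∈ A ∧ y ∉ A ∧ (x ∈ P ↔ y ∈ P)) ≤
      (∑ m ∈ Finset.Icc 1 n,
        pairSum J α (fun x y => (x ∈ (A : Set (Site d)) ∧ x ∈ U m) ∧ y ∈ (A : Set (Site d))ᶜ)) +
      (∑ m ∈ Finset.Icc 1 n,
        pairSum J α (fun x y => (y ∈ (A : Set (Site d))ᶜ ∧ y ∈ U m) ∧ x ∈ (A : Set (Site d)))) +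
      pairSum J α (fun x y => x ∈ A ∧ r n < nrm (x - y)) := by
    refine (pairSum_le_add J α _
      (fun x y => (∃ m ∈ Finset.Icc 1 n, (x ∈ (A : Set (Site d)) ∧ x ∈ U m) ∧
          y ∈ (A : Set (Site d))ᶜ) ∨
        (∃ m ∈ Finset.Icc 1 n, (y ∈ (A : Set (Site d))ᶜ ∧ y ∈ U m) ∧ x ∈ (A : Set (Site d))))
      (fun x y => x ∈ A ∧ r n < nrm (x - y)) ?_).trans ?_
    · rintro x y ⟨hx, hy, hxy⟩
      obtain ⟨B, hB, hBA, hsep⟩ := hΓ.exists_separates hA hxy hx hy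
      have hB1 : 1 ≤ (bdry B).card := (hΓ.nonempty B hB).card_pos
      rcases le_or_gt (bdry B).card n with hle | hgt
      · left
        have hm : (bdry B).card ∈ Finset.Icc 1 n := Finset.mem_Icc.2 ⟨hB1, hle⟩
        by_cases hxB : x ∈ B
        · exact Or.inl ⟨_, hm, ⟨hx, B, hB, hBA, rfl, hxB⟩, hy⟩
        · exact Or.inr ⟨_, hm, ⟨hy, B, hB, hBA, rfl, by tauto⟩, hx⟩
      · right
        refine ⟨hx, ?_⟩
        -- Otherwise `bdry B` has an edge within `r n` of `x`, and `bdry A` has one within `n ^ 2 ≤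
        -- r n`, against their distance of more than `8 * r n`.
        by_contra hc
        rw [not_lt] at hc
        obtain ⟨e, he, he2⟩ := exists_mem_bdry_near hd hx
        obtain ⟨f, hf, hf2⟩ := exists_mem_bdry_of_separates hsep
        have h1 := hfar A hA B hB hBA.symm e he f hf
        rw [← hn, min_eq_left hgt.le] at h1
        have h2 := hdist e f x
        have h3 := hr_sq n hn1
        rw [← hn] at he2
        omega
    · gcongr
      refine (pairSum_le_add J α _ _ _ fun x y h => h).trans ?_
      gcongr
      · exact pairSum_le_sum J α _ _ _ fun x y h => h
      · exact pairSum_le_sum J α _ _ _ fun x y h => h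
  have hsum : ∑ m ∈ Finset.Icc 1 n, ENNReal.ofReal (2 ^ α / M * (1 / (m : ℝ) ^ 2)) * cut ≤
      ENNReal.ofReal (1 / 32) * cut := by
    rw [← Finset.sum_mul, ← ENNReal.ofReal_sum_of_nonneg fun m _ => by positivity,
      ← Finset.mul_sum]
    gcongr
    have h1 := sum_inv_sq_le n
    have hM0 : (0 : ℝ) < M := by exact_mod_cast hM1
    have h2 : (2 : ℝ) ^ α / M ≤ 1 / 64 := by
      rw [div_le_div_iff₀ hM0 (by norm_num)]; linarith
    have h3 : ∑ m ∈ Finset.Icc 1 n, 1 / (m : ℝ) ^ 2 ≤ 2 := by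
      have : (0 : ℝ) ≤ 1 / n := by positivity
      linarith
    calc _ ≤ 1 / 64 * (2 : ℝ) := by gcongr
      _ = 1 / 32 := by norm_num
  calc 8 * pairSum J α (fun x y => x ∈ A ∧ y ∉ A ∧ (x ∈ P ↔ y ∈ P))
      ≤ 8 * (ENNReal.ofReal (1 / 32) * cut + ENNReal.ofReal (1 / 32) * cut +
          ENNReal.ofReal (1 / 16) * cut) := by
        gcongr
        refine hsplit.trans ?_
        gcongr
        · exact (Finset.sum_le_sum fun m hm => hsmall m hm (_, _) (Or.inl rfl)).trans hsum
        · refine (Finset.sum_le_sum fun m hm => ?_).trans hsum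
          rw [pairSum_comm]
          exact hsmall m hm (_, _) (Or.inr rfl)
    _ = ENNReal.ofReal (8 * (1 / 32 + 1 / 32 + 1 / 16)) * cut := by
        rw [ENNReal.ofReal_mul (by norm_num), ENNReal.ofReal_add (by norm_num) (by norm_num),
          ENNReal.ofReal_add (by norm_num) (by norm_num)]
        have : ENNReal.ofReal 8 = 8 := by norm_num
        rw [this]
        ring
    _ = cut := by norm_num

/-! ### Hardy inequalities for the field -/

/-- The profile `|x|^{-s}`, with the value `1` at the origin. -/
noncomputable def decay {d : ℕ} (s : ℝ) (x : Site d) : ℝ :=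
  if x = 0 then 1 else 1 / (nrm x : ℝ) ^ s

theorem decay_nonneg {d : ℕ} (s : ℝ) (x : Site d) : 0 ≤ decay s x := by
  unfold decay
  split_ifs <;> positivity

theorem nrm_add_unit {d : ℕ} (x : Site d) (i : Fin d) :
    nrm (x + unit i) + (x i).natAbs = nrm x + (x i + 1).natAbs := by
  unfold nrm
  rw [← Finset.add_sum_erase _ _ (Finset.mem_univ i),
    ← Finset.add_sum_erase _ (fun j => (x j).natAbs) (Finset.mem_univ i)]
  have : ∑ j ∈ Finset.univ.erase i, ((x + unit i) j).natAbs
      = ∑ j ∈ Finset.univ.erase i, (x j).natAbs := by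
    refine Finset.sum_congr rfl fun j hj => ?_
    simp [unit_ne (Finset.ne_of_mem_erase hj)]
  rw [this]
  simp only [Pi.add_apply, unit_self]
  ring

/-- The divergence theorem on the lattice, in one direction. -/
theorem sum_shift_sub_le {d : ℕ} (A : Finset (Site d)) (i : Fin d) (f : Site d → ℝ)
    (hf : ∀ x, |f x| ≤ 1) :
    ∑ x ∈ A, (f (x + unit i) - f x) ≤ ((bdry A).filter fun e => e.2 = i).card := by
  classical
  set B := A.map (addRightEmbedding (unit i)) with hB
  have hBm : ∀ z, z ∈ B ↔ z - unit i ∈ A := by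
    intro z
    simp only [hB, Finset.mem_map, addRightEmbedding_apply]
    constructor
    · rintro ⟨x, hx, rfl⟩
      simpa using hx
    · intro h
      exact ⟨_, h, by simp⟩
  have h1 : ∑ x ∈ A, f (x + unit i) = ∑ x ∈ B, f x := by simp [hB]
  rw [Finset.sum_sub_distrib, h1, ← Finset.sum_sdiff_sub_sum_sdiff]
  have h2 : ∑ z ∈ B \ A, f z ≤ (B \ A).card := by
    rw [← nsmul_one, ← Finset.sum_const]
    exact Finset.sum_le_sum fun z _ => (le_abs_self _).trans (hf z)
  have h3 : -∑ z ∈ A \ B, f z ≤ (A \ B).card := by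
    rw [← nsmul_one, ← Finset.sum_const, ← Finset.sum_neg_distrib]
    exact Finset.sum_le_sum fun z _ => (neg_le_abs _).trans (hf z)
  have h4 : (B \ A).card + (A \ B).card ≤ ((bdry A).filter fun e => e.2 = i).card := by
    rw [← Finset.card_union_of_disjoint
      (Finset.disjoint_left.2 fun z hz hz' => (Finset.mem_sdiff.1 hz).2 (Finset.mem_sdiff.1 hz').1)]
    refine Finset.card_le_card_of_injOn (fun z => (z - unit i, i)) ?_ ?_
    · intro z hz
      simp only [Finset.coe_filter, Set.mem_ofPred_eq, and_true, mem_bdry, sub_add_cancel]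
      simp only [Finset.coe_union, Finset.coe_sdiff, Set.mem_union, Set.mem_sdiff, Finset.mem_coe,
        hBm] at hz
      tauto
    · intro z _ w _ h
      simpa using h
  have h5 : ((B \ A).card : ℝ) + (A \ B).card ≤ ((bdry A).filter fun e => e.2 = i).card := by
    exact_mod_cast h4
  linarith

/-- A discrete Hardy inequality: the field `|x|^{-1}` summed over `A` is bounded by the perimeter
of `A`. -/
theorem sum_decay_one_le {d : ℕ} (hd : 2 ≤ d) (A : Finset (Site d)) :
    ∑ x ∈ A, decay 1 x ≤ 2 * (bdry A).card := by
  -- A discrete radial vector field with components of modulus at most 1. With `N = nrm x` its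
  -- divergence is at least `(d * (N + 1) - N) / ((N + 1) * (N + 2))`, which is at least `1 / (N +
  -- 1)` because `d ≥ 2`.
  let F : Fin d → Site d → ℝ := fun i x => x i / ((nrm x : ℝ) + 1)
  have habs : ∀ (x : Site d) (i : Fin d), |(x i : ℝ)| = (x i).natAbs := fun x i => by
    rw [Nat.cast_natAbs]; simp
  have hle : ∀ (x : Site d) (i : Fin d), |(x i : ℝ)| ≤ nrm x := fun x i => by
    rw [habs]
    exact_mod_cast Finset.single_le_sum (f := fun i => (x i).natAbs) (fun _ _ => Nat.zero_le _)
      (Finset.mem_univ i)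
  have hF : ∀ i x, |F i x| ≤ 1 := by
    intro i x
    have hN : (0 : ℝ) < (nrm x : ℝ) + 1 := by positivity
    rw [abs_div, abs_of_pos hN, div_le_one hN]
    linarith [hle x i]
  have hdiv : ∀ i x, ((nrm x : ℝ) + 1 - |(x i : ℝ)|) / (((nrm x : ℝ) + 1) * (nrm x + 2)) ≤
      F i (x + unit i) - F i x := by
    intro i x
    have h1 := nrm_add_unit x i
    have h2 := hle x i
    have hN : (0 : ℝ) ≤ (nrm x : ℝ) := by positivity
    simp only [F, Pi.add_apply, unit_self]
    rcases le_or_gt 0 (x i) with h0 | h0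
    · have h3 : nrm (x + unit i) = nrm x + 1 := by omega
      have h0' : (0 : ℝ) ≤ x i := by exact_mod_cast h0
      rw [h3, abs_of_nonneg h0']
      push_cast
      refine le_of_eq ?_
      field_simp
      ring
    · have h3 : (nrm (x + unit i) : ℝ) + 1 = nrm x := by
        have : nrm (x + unit i) + 1 = nrm x := by omega
        exact_mod_cast this
      have h0' : (x i : ℝ) ≤ -1 := by exact_mod_cast (by omega : x i ≤ -1)
      rw [h3, abs_of_neg (by linarith)]
      rw [abs_of_neg (by linarith)] at h2
      push_cast
      have hN' : (1 : ℝ) ≤ (nrm x : ℝ) := by linarith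
      have e : ((x i : ℝ) + 1) / nrm x - x i / (nrm x + 1) =
          ((nrm x : ℝ) + 1 - -(x i : ℝ)) / ((nrm x + 1) * nrm x) := by
        field_simp
        ring
      rw [e]
      gcongr
      · linarith
      · linarith
  have hpt : ∀ x, decay 1 x / 2 ≤ ∑ i, (F i (x + unit i) - F i x) := by
    intro x
    refine le_trans ?_ (Finset.sum_le_sum fun i _ => hdiv i x)
    rw [← Finset.sum_div, Finset.sum_sub_distrib]
    have e : ∑ i, |(x i : ℝ)| = nrm x := l1_eq_nrm x
    rw [e]
    simp only [Finset.sum_const, Finset.card_univ, Fintype.card_fin, nsmul_eq_mul]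
    have hd' : (2 : ℝ) ≤ d := by exact_mod_cast hd
    have hN : (0 : ℝ) ≤ (nrm x : ℝ) := by positivity
    have h1 : 1 / ((nrm x : ℝ) + 1) ≤
        ((d : ℝ) * ((nrm x : ℝ) + 1) - nrm x) / (((nrm x : ℝ) + 1) * (nrm x + 2)) := by
      rw [div_le_div_iff₀ (by positivity) (by positivity)]
      have : (nrm x : ℝ) + 2 ≤ (d : ℝ) * ((nrm x : ℝ) + 1) - nrm x := by nlinarith
      nlinarith
    refine le_trans ?_ h1
    unfold decay
    split_ifs with h
    · simp [h]
      norm_num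
    · have : (1 : ℝ) ≤ nrm x := by exact_mod_cast nrm_pos h
      rw [Real.rpow_one, div_div, div_le_div_iff₀ (by positivity) (by positivity)]
      linarith
  have h1 : ∑ x ∈ A, decay 1 x / 2 ≤ (bdry A).card := by
    calc _ ≤ ∑ x ∈ A, ∑ i, (F i (x + unit i) - F i x) := Finset.sum_le_sum fun x _ => hpt x
      _ = ∑ i, ∑ x ∈ A, (F i (x + unit i) - F i x) := Finset.sum_comm
      _ ≤ ∑ i, (((bdry A).filter fun e => e.2 = i).card : ℝ) :=
        Finset.sum_le_sum fun i _ => sum_shift_sub_le A i (F i) (hF i)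
      _ = (bdry A).card := by
        rw [Finset.card_eq_sum_card_fiberwise (f := fun e : Edge d => e.2) (t := Finset.univ)
          (fun _ _ => by simp)]
        push_cast
        rfl
  rw [← Finset.sum_div] at h1
  linarith

/-- The induction step is Bernoulli's inequality for the concave power `1 - s`, applied to `1 - 1 /
(n + 1)`. -/
theorem sum_Icc_rpow_neg_le {s : ℝ} (hs0 : 0 < s) (hs1 : s < 1) (n : ℕ) :
    ∑ t ∈ Finset.Icc 1 n, (t : ℝ) ^ (-s) ≤ (n : ℝ) ^ (1 - s) / (1 - s) := by
  have h1s : 0 < 1 - s := by linarith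
  induction n with
  | zero => simp [Real.zero_rpow h1s.ne']
  | succ n ih =>
    rw [Finset.sum_Icc_succ_top (by omega)]
    have hn : (0 : ℝ) < ((n + 1 : ℕ) : ℝ) := by positivity
    have hb := rpow_one_add_le_one_add_mul_self (s := -(1 / ((n + 1 : ℕ) : ℝ)))
      (by
        rw [neg_le_neg_iff, div_le_one hn]
        push_cast
        linarith [(Nat.cast_nonneg n : (0 : ℝ) ≤ n)]) h1s.le (by linarith : 1 - s ≤ 1)
    have e1 : (1 + -(1 / ((n + 1 : ℕ) : ℝ))) = n / ((n + 1 : ℕ) : ℝ) := by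
      field_simp
      push_cast
      ring
    rw [e1, Real.div_rpow (by positivity) hn.le, div_le_iff₀ (by positivity)] at hb
    have e2 : ((n + 1 : ℕ) : ℝ) ^ (1 - s) = ((n + 1 : ℕ) : ℝ) * ((n + 1 : ℕ) : ℝ) ^ (-s) := by
      rw [sub_eq_add_neg, Real.rpow_add hn, Real.rpow_one]
    have e3 : (1 + (1 - s) * -(1 / ((n + 1 : ℕ) : ℝ))) * ((n + 1 : ℕ) : ℝ) ^ (1 - s)
        = ((n + 1 : ℕ) : ℝ) ^ (1 - s) - (1 - s) * ((n + 1 : ℕ) : ℝ) ^ (-s) := by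
      rw [e2]
      field_simp
      ring
    rw [e3] at hb
    rw [le_div_iff₀ h1s] at ih ⊢
    linarith

/-- As `s < 1`, nothing essential is lost by replacing the norm with one coordinate (at least 1).
The sum then factors into a one-dimensional sum of order `r ^ (1 - s)` and `d - 1` side lengths. -/
theorem sum_box_decay_le {d : ℕ} (hd : 0 < d) {s : ℝ} (hs0 : 0 < s) (hs1 : s < 1) {r : ℕ}
    (hr : 1 ≤ r) :
    ∑ x ∈ Finset.Icc (fun _ => -(r : ℤ) : Site d) (fun _ => (r : ℤ)), decay s x ≤
      3 ^ d / (1 - s) * ((r : ℝ) ^ d * (r : ℝ) ^ (-s)) := by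
  classical
  let i₀ : Fin d := ⟨0, hd⟩
  have h1s : 0 < 1 - s := by linarith
  have hr' : (1 : ℝ) ≤ r := by exact_mod_cast hr
  let g : ℤ → ℝ := fun t => (max 1 t.natAbs : ℕ) ^ (-s)
  have hpt : ∀ x : Site d, decay s x ≤ g (x i₀) := by
    intro x
    unfold decay
    split_ifs with h
    · simp [g, h]
    · have h1 : 1 ≤ nrm x := nrm_pos h
      have h2 : (x i₀).natAbs ≤ nrm x :=
        Finset.single_le_sum (f := fun i => (x i).natAbs) (fun _ _ => Nat.zero_le _)
          (Finset.mem_univ i₀)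
      rw [one_div, ← Real.rpow_neg (Nat.cast_nonneg _)]
      refine Real.rpow_le_rpow_of_nonpos ?_ ?_ (by linarith)
      · exact_mod_cast lt_of_lt_of_le one_pos (le_max_left _ _)
      · exact_mod_cast max_le h1 h2
  have hg : ∑ t ∈ Finset.Icc (-(r : ℤ)) r, g t ≤ 3 / (1 - s) * (r * (r : ℝ) ^ (-s)) := by
    have hev : g.Even := fun t => by simp [g]
    rw [Finset.sum_Icc_of_even_eq_range hev, Finset.sum_range_succ']
    have e0 : g 0 = 1 := by simp [g]
    have e1 : ∑ k ∈ Finset.range r, g ((k + 1 : ℕ) : ℤ) = ∑ t ∈ Finset.Icc 1 r, (t : ℝ) ^ (-s) := by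
      rw [Finset.range_eq_Ico, Finset.sum_Ico_add' (fun t : ℕ => g (t : ℤ)) 0 r 1]
      refine Finset.sum_congr (by ext; simp) fun t ht => ?_
      simp only [g, Int.natAbs_natCast]
      rw [max_eq_right (by simp at ht; omega)]
    have e2 : (r : ℝ) ^ (1 - s) = r * (r : ℝ) ^ (-s) := by
      rw [sub_eq_add_neg, Real.rpow_add (by positivity), Real.rpow_one]
    have h1 := sum_Icc_rpow_neg_le hs0 hs1 r
    have h2 : 1 ≤ (r : ℝ) ^ (1 - s) / (1 - s) := by
      rw [le_div_iff₀ h1s]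
      have := Real.one_le_rpow hr' h1s.le
      linarith
    simp only [Nat.cast_zero, e0, e1, nsmul_eq_mul]
    rw [← e2, div_mul_eq_mul_div, mul_div_assoc]
    push_cast
    linarith
  have hprod : ∑ x ∈ Finset.Icc (fun _ => -(r : ℤ) : Site d) (fun _ => (r : ℤ)), g (x i₀)
      = (∑ t ∈ Finset.Icc (-(r : ℤ)) r, g t) * ((2 * r + 1 : ℕ) : ℝ) ^ (d - 1) := by
    have h := Finset.prod_univ_sum (fun _ : Fin d => Finset.Icc (-(r : ℤ)) r)
      (fun i t => if i = i₀ then g t else 1)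
    rw [← Finset.mul_prod_erase _ _ (Finset.mem_univ i₀)] at h
    simp only [if_true] at h
    have h2 : ∀ i ∈ Finset.univ.erase i₀, (∑ t ∈ Finset.Icc (-(r : ℤ)) r,
        if i = i₀ then g t else 1) = ((2 * r + 1 : ℕ) : ℝ) := by
      intro i hi
      simp only [Finset.ne_of_mem_erase hi, if_false, Finset.sum_const, Int.card_Icc, nsmul_one]
      congr 1
      omega
    have h3 : ∀ x : Site d, (∏ i, if i = i₀ then g (x i) else 1) = g (x i₀) := fun x => by
      simp
    rw [Finset.prod_congr rfl h2, Finset.prod_const, Finset.card_erase_of_mem (Finset.mem_univ _),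
      Finset.card_univ, Fintype.card_fin] at h
    rw [h, Pi.Icc_eq]
    exact Finset.sum_congr rfl fun x _ => (h3 x).symm
  calc _ ≤ _ := Finset.sum_le_sum fun x _ => hpt x
    _ = _ := hprod
    _ ≤ (3 / (1 - s) * (r * (r : ℝ) ^ (-s))) * (3 * r) ^ (d - 1) := by
        gcongr
        push_cast
        linarith
    _ = _ := by
        obtain ⟨k, rfl⟩ : ∃ k, d = k + 1 := ⟨d - 1, by omega⟩
        simp only [Nat.add_sub_cancel]
        rw [mul_pow, pow_succ, pow_succ]
        ring

theorem card_box {d : ℕ} (x : Site d) (r : ℕ) :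
    (Finset.Icc (fun i => x i - r : Site d) (fun i => x i + r)).card = (2 * r + 1) ^ d := by
  rw [Pi.card_Icc]
  simp only [Int.card_Icc]
  rw [Finset.prod_congr rfl fun i _ => (by omega :
    (x i + r + 1 - (x i - r)).toNat = 2 * r + 1)]
  simp

/-- A discrete fractional Hardy inequality. -/
theorem sum_decay_frac_le {d : ℕ} (hd : 0 < d) {J α s : ℝ} (hJ : 0 < J) (hs0 : 0 < s) (hs1 : s < 1)
    (hα : α = d + s) :
    ∃ K : ℝ, 0 < K ∧ ∀ A : Finset (Site d), ENNReal.ofReal (∑ x ∈ A, decay s x) ≤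
      ENNReal.ofReal K * pairSum J α fun x y => x ∈ A ∧ y ∉ A := by
  classical
  have h1s : 0 < 1 - s := by linarith
  have hd' : (0 : ℝ) < d := by exact_mod_cast hd
  have hα0 : 0 < α := by rw [hα]; positivity
  refine ⟨(2 * (3 ^ d / (1 - s)) + 1) * (2 * (d : ℝ) ^ α / J), by positivity, fun A => ?_⟩
  rcases A.eq_empty_or_nonempty with rfl | hA
  · simp
  set N := A.card with hN
  have hN1 : 1 ≤ N := hA.card_pos
  -- The least `r` for which a box of radius `r` has at least `2 * N` sites. Such a box, wherever it
  -- is centred, has at least `N` sites outside `A`, and minimality gives `r ^ d ≤ 2 * N`.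
  have hex : ∃ r : ℕ, 2 * N ≤ (2 * r + 1) ^ d :=
    ⟨N, by
      calc 2 * N ≤ (2 * N + 1) ^ 1 := by rw [pow_one]; omega
        _ ≤ (2 * N + 1) ^ d := Nat.pow_le_pow_right (by omega) hd⟩
  set r := Nat.find hex with hr
  have hr2 : 2 * N ≤ (2 * r + 1) ^ d := Nat.find_spec hex
  have hr1 : 1 ≤ r := by
    by_contra h
    have h0 : r = 0 := by omega
    rw [h0] at hr2
    simp at hr2
    omega
  have hrN : r ^ d ≤ 2 * N := by
    have := Nat.find_min hex (m := r - 1) (by omega)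
    rw [not_le] at this
    refine le_trans (Nat.pow_le_pow_left ?_ d) this.le
    omega
  have hr' : (0 : ℝ) < r := by exact_mod_cast hr1
  have hN' : (0 : ℝ) < N := by exact_mod_cast hN1
  have hrN' : (r : ℝ) ^ d ≤ 2 * N := by exact_mod_cast hrN
  -- the field
  have hupper : ∑ x ∈ A, decay s x ≤ (2 * (3 ^ d / (1 - s)) + 1) * (N * (r : ℝ) ^ (-s)) := by
    set B := Finset.Icc (fun _ => -(r : ℤ) : Site d) (fun _ => (r : ℤ)) with hB
    -- Inside the box `A` is enlarged to the whole box; outside it every term is at most `r ^ (-s)`.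
    -- Both parts are of order `N * r ^ (-s)`.
    rw [← Finset.sum_filter_add_sum_filter_not A (fun x => x ∈ B)]
    have h1 : ∑ x ∈ A.filter (fun x => x ∈ B), decay s x ≤
        3 ^ d / (1 - s) * ((r : ℝ) ^ d * (r : ℝ) ^ (-s)) := by
      refine le_trans (Finset.sum_le_sum_of_subset_of_nonneg (fun x hx => ?_)
        fun x _ _ => decay_nonneg s x) (sum_box_decay_le hd hs0 hs1 hr1)
      exact (Finset.mem_filter.1 hx).2
    have h2 : ∑ x ∈ A.filter (fun x => x ∉ B), decay s x ≤ N * (r : ℝ) ^ (-s) := by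
      calc _ ≤ ∑ x ∈ A.filter (fun x => x ∉ B), (r : ℝ) ^ (-s) := by
            refine Finset.sum_le_sum fun x hx => ?_
            have hxB := (Finset.mem_filter.1 hx).2
            have hrn : r ≤ nrm x := by
              by_contra hlt
              apply hxB
              rw [hB, Finset.mem_Icc, Pi.le_def, Pi.le_def]
              have h3 : ∀ i, (x i).natAbs ≤ nrm x := fun i =>
                Finset.single_le_sum (f := fun i => (x i).natAbs) (fun _ _ => Nat.zero_le _)
                  (Finset.mem_univ i)
              constructor <;> intro i <;> have := h3 i <;> omega
            unfold decay
            rw [if_neg (fun h => by rw [h, nrm_zero] at hrn; omega), one_div,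
              ← Real.rpow_neg (Nat.cast_nonneg _)]
            exact Real.rpow_le_rpow_of_nonpos hr' (by exact_mod_cast hrn) (by linarith)
        _ ≤ _ := by
            rw [Finset.sum_const, nsmul_eq_mul]
            gcongr
            exact Finset.card_le_card (Finset.filter_subset _ _)
    have h3 : 3 ^ d / (1 - s) * ((r : ℝ) ^ d * (r : ℝ) ^ (-s)) ≤
        3 ^ d / (1 - s) * (2 * N * (r : ℝ) ^ (-s)) := by gcongr
    linarith
  -- the interaction
  have hlower : ENNReal.ofReal (N * (N * (J / (d * r : ℝ) ^ α))) ≤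
      pairSum J α fun x y => x ∈ A ∧ y ∉ A := by
    unfold pairSum
    refine le_trans ?_ (ENNReal.sum_le_tsum A)
    rw [ENNReal.ofReal_mul (Nat.cast_nonneg _), ENNReal.ofReal_natCast, hN, ← nsmul_eq_mul,
      ← Finset.sum_const]
    refine Finset.sum_le_sum fun x hx => ?_
    set B := Finset.Icc (fun i => x i - r : Site d) (fun i => x i + r) with hB
    refine le_trans ?_ (ENNReal.sum_le_tsum (B \ A))
    have hcard : N ≤ (B \ A).card := by
      have h1 := Finset.le_card_sdiff A B
      rw [card_box] at h1
      omega
    rw [← hN, ENNReal.ofReal_mul (Nat.cast_nonneg _), ENNReal.ofReal_natCast]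
    calc (N : ℝ≥0∞) * ENNReal.ofReal (J / (d * r : ℝ) ^ α)
        ≤ (B \ A).card * ENNReal.ofReal (J / (d * r : ℝ) ^ α) := by gcongr
      _ = ∑ _y ∈ B \ A, ENNReal.ofReal (J / (d * r : ℝ) ^ α) := by
          rw [Finset.sum_const, nsmul_eq_mul]
      _ ≤ _ := by
          refine Finset.sum_le_sum fun y hy => ?_
          rw [Finset.mem_sdiff] at hy
          rw [if_pos ⟨hx, hy.2⟩]
          refine ENNReal.ofReal_le_ofReal ?_
          have hxy : x ≠ y := fun h => hy.2 (h ▸ hx)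
          unfold coupling
          rw [if_neg hxy, l1_eq_nrm]
          have h1 : (0 : ℝ) < nrm (x - y) := by exact_mod_cast nrm_pos (sub_ne_zero.2 hxy)
          have h2 : (nrm (x - y) : ℝ) ≤ d * r := by
            have : nrm (x - y) ≤ ∑ _i : Fin d, r := by
              refine Finset.sum_le_sum fun i _ => ?_
              have h3 := hy.1
              rw [hB, Finset.mem_Icc, Pi.le_def, Pi.le_def] at h3
              have h4 := h3.1 i
              have h5 := h3.2 i
              rw [Pi.sub_apply]
              omega
            rw [Finset.sum_const, Finset.card_univ, Fintype.card_fin, smul_eq_mul] at this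
            exact_mod_cast this
          gcongr
  calc ENNReal.ofReal (∑ x ∈ A, decay s x)
      ≤ ENNReal.ofReal ((2 * (3 ^ d / (1 - s)) + 1) * (2 * (d : ℝ) ^ α / J) *
          (N * (N * (J / (d * r : ℝ) ^ α)))) := by
        refine ENNReal.ofReal_le_ofReal (hupper.trans ?_)
        have e : (d * r : ℝ) ^ α = (d : ℝ) ^ α * ((r : ℝ) ^ d * (r : ℝ) ^ s) := by
          rw [Real.mul_rpow hd'.le hr'.le]
          congr 1
          rw [hα, Real.rpow_add hr', Real.rpow_natCast]
        rw [e, Real.rpow_neg hr'.le]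
        have hdα : (0 : ℝ) < (d : ℝ) ^ α := by positivity
        have hrd : (0 : ℝ) < (r : ℝ) ^ d := by positivity
        have hrs : (0 : ℝ) < (r : ℝ) ^ s := by positivity
        -- Up to constants, the interaction `N ^ 2 / r ^ (d + s)` exceeds `N * r ^ (-s)` by the
        -- factor `N / r ^ d ≥ 1 / 2`.
        have e2 : 2 * (d : ℝ) ^ α / J * (N * (N * (J / ((d : ℝ) ^ α * ((r : ℝ) ^ d * (r : ℝ) ^ s)))))
            = N * ((r : ℝ) ^ s)⁻¹ * (2 * N / (r : ℝ) ^ d) := by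
          field_simp
        rw [mul_assoc, e2]
        refine mul_le_mul_of_nonneg_left ?_ (by positivity)
        exact le_mul_of_one_le_right (by positivity) ((one_le_div hrd).2 hrN')
    _ = ENNReal.ofReal ((2 * (3 ^ d / (1 - s)) + 1) * (2 * (d : ℝ) ^ α / J)) *
          ENNReal.ofReal (N * (N * (J / (d * r : ℝ) ^ α))) := ENNReal.ofReal_mul (by positivity)
    _ ≤ _ := by gcongr

/-- For `s = 1` the perimeter part of the interaction suffices, whatever `α` is; the smaller
exponent `α - d` needs its long-range part. -/
theorem exists_sum_decay_le {d : ℕ} (hd : 2 ≤ d) {J α s : ℝ} (hJ : 0 < J) (hα : (d : ℝ) < α)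
    (hs : (α < d + 1 ∧ s = α - d) ∨ s = 1) :
    ∃ K : ℝ, 0 < K ∧ ∀ A : Finset (Site d), ENNReal.ofReal (∑ x ∈ A, decay s x) ≤
      ENNReal.ofReal K * pairSum J α fun x y => x ∈ A ∧ y ∉ A := by
  rcases hs with ⟨h1, h2⟩ | rfl
  · exact sum_decay_frac_le (by omega) hJ (by linarith) (by linarith) (by linarith)
  · refine ⟨2 / J, by positivity, fun A => ?_⟩
    calc _ ≤ ENNReal.ofReal (2 * (bdry A).card) := ENNReal.ofReal_le_ofReal (sum_decay_one_le hd A)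
      _ = ENNReal.ofReal (2 / J) * (ENNReal.ofReal J * (bdry A).card) := by
        rw [← ENNReal.ofReal_natCast, ← ENNReal.ofReal_mul hJ.le,
          ← ENNReal.ofReal_mul (by positivity)]
        congr 1
        field_simp
      _ ≤ _ := by
        gcongr
        exact card_bdry_le_pairSum α A

/-! ### The energy gained by reversing a set of spins -/

theorem spin_neg (s : ℤˣ) : spin (-s) = -spin s := by simp [spin]

theorem spin_mul_spin (s t : ℤˣ) : spin s * spin t = if s = t then 1 else -1 := by
  rcases Int.units_eq_one_or s with rfl | rfl <;> rcases Int.units_eq_one_or t with rfl | rfl <;>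
    simp [spin]

theorem abs_spin (s : ℤˣ) : |spin s| = 1 := by
  rcases Int.units_eq_one_or s with rfl | rfl <;> simp [spin]

theorem summable_coupling {d : ℕ} (hd : 0 < d) {J α : ℝ} (hJ : 0 ≤ J) (hα : (d : ℝ) < α)
    (x : Site d) : Summable fun y => coupling J α x y := by
  have h1 : Summable fun y : Site d => (1 + (nrm (x - y) : ℝ)) ^ (-α) :=
    (Equiv.subLeft x).summable_iff.2 (summable_nrm_rpow hd hα)
  exact Summable.of_nonneg_of_le (fun y => coupling_nonneg hJ x y)
    (fun y => coupling_le hJ ((Nat.cast_nonneg d).trans hα.le) x y) (h1.mul_left _)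

open Classical in
/-- The total coupling of the pairs `(x, y)` with `x ∈ A` that satisfy `r`, as a real number. -/
noncomputable def realPairSum {d : ℕ} (J α : ℝ) (A : Finset (Site d))
    (r : Site d → Site d → Prop) : ℝ :=
  ∑ x ∈ A, ∑' y, if r x y then coupling J α x y else 0

theorem realPairSum_nonneg {d : ℕ} {J : ℝ} (hJ : 0 ≤ J) (α : ℝ) (A : Finset (Site d))
    (r : Site d → Site d → Prop) : 0 ≤ realPairSum J α A r := by
  refine Finset.sum_nonneg fun x _ => tsum_nonneg fun y => ?_
  split_ifs
  · exact coupling_nonneg hJ x y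
  · rfl

/-- Bounds on interactions are proved for extended nonnegative reals; the energy identity needs
subtraction, hence this passage to real numbers. -/
theorem pairSum_eq_ofReal {d : ℕ} (hd : 0 < d) {J α : ℝ} (hJ : 0 ≤ J) (hα : (d : ℝ) < α)
    (A : Finset (Site d)) (r : Site d → Site d → Prop) (hr : ∀ x y, r x y → x ∈ A) :
    pairSum J α r =
      ENNReal.ofReal (realPairSum J α A r) := by
  classical
  have hnn : ∀ x y, 0 ≤ if r x y then coupling J α x y else 0 := fun x y => by
    split_ifs
    · exact coupling_nonneg hJ x y
    · rfl
  unfold pairSum realPairSum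
  rw [tsum_eq_sum (s := A), ENNReal.ofReal_sum_of_nonneg fun x _ => tsum_nonneg fun y => by
    convert hnn x y]
  · refine Finset.sum_congr rfl fun x _ => ?_
    rw [ENNReal.ofReal_tsum_of_nonneg fun y => by convert hnn x y]
    · refine tsum_congr fun y => ?_
      split_ifs <;> simp
    · refine Summable.of_nonneg_of_le (fun y => by convert hnn x y) (fun y => ?_) (summable_coupling hd hJ hα x)
      split_ifs
      · rfl
      · exact coupling_nonneg hJ x y
  · intro x hx
    have h : ∀ y, ¬ r x y := fun y h => hx (hr x y h)
    simp [h]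

/-- The configuration with the spins in `A` reversed. -/
def flip {d : ℕ} (A : Finset (Site d)) (σ : Config d) : Config d :=
  fun x => if x ∈ A then -σ x else σ x

/-- The energy difference caused by reversing the spins in `A`. -/
theorem hamiltonian_sub_flip {d : ℕ} (hd : 0 < d) {J α : ℝ} (hJ : 0 ≤ J) (hα : (d : ℝ) < α)
    (h : Site d → ℝ) {Λ A : Finset (Site d)} (hA : A ⊆ Λ) {ω σ : Config d}
    (hσ : ∀ x ∉ Λ, σ x = ω x) :
    hamiltonian J α h Λ ω σ - hamiltonian J α h Λ ω (flip A σ) =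
      2 * realPairSum J α A (fun x y => x ∈ A ∧ y ∉ A)
      - 4 * realPairSum J α A (fun x y => x ∈ A ∧ y ∉ A ∧ σ x = σ y)
      - 2 * ∑ x ∈ A, h x * spin (σ x) := by
  classical
  have hs : ∀ x, Summable fun y => coupling J α x y := summable_coupling hd hJ hα
  have hflip : ∀ x, spin (flip A σ x) = if x ∈ A then -spin (σ x) else spin (σ x) := by
    intro x
    unfold flip
    split_ifs
    · exact spin_neg _
    · rfl
  let k : Site d → Site d → ℝ := fun x y => coupling J α x y * spin (σ x) * spin (σ y)
  have hk : ∀ x y, k x y = k y x := fun x y => by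
    simp only [k]
    rw [coupling_comm]
    ring
  have hks : ∀ x, Summable fun y => if y ∉ A then k x y else 0 := fun x => by
    refine Summable.of_norm_bounded (hs x) fun y => ?_
    by_cases hy : y ∈ A
    · simpa [hy] using coupling_nonneg hJ x y
    · simp [hy, k, abs_spin, abs_of_nonneg (coupling_nonneg hJ x y)]
  -- pairs inside the volume
  have h1 : ∑ x ∈ Λ, ∑ y ∈ Λ, coupling J α x y * spin (σ x) * spin (σ y)
      - ∑ x ∈ Λ, ∑ y ∈ Λ, coupling J α x y * spin (flip A σ x) * spin (flip A σ y)
      = 4 * ∑ x ∈ A, ∑ y ∈ Λ, if y ∉ A then k x y else 0 := by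
    have e1 : ∑ x ∈ A, ∑ y ∈ Λ, (if y ∉ A then k x y else 0)
        = ∑ x ∈ Λ, ∑ y ∈ Λ, if x ∈ A ∧ y ∉ A then k x y else 0 := by
      rw [← Finset.sum_subset hA (f := fun x => ∑ y ∈ Λ, if x ∈ A ∧ y ∉ A then k x y else 0)]
      · exact Finset.sum_congr rfl fun x hx => by simp [hx]
      · intro x _ hx
        simp [hx]
    have e2 : ∑ x ∈ Λ, ∑ y ∈ Λ, (if x ∈ A ∧ y ∉ A then k x y else 0)
        = ∑ x ∈ Λ, ∑ y ∈ Λ, if y ∈ A ∧ x ∉ A then k x y else 0 := by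
      rw [Finset.sum_comm]
      exact Finset.sum_congr rfl fun x _ => Finset.sum_congr rfl fun y _ => by rw [hk]
    -- Only pairs with exactly one site in `A` change sign. The factor 4 is 2 for the sign change
    -- times 2 for the two orders of a pair.
    have e3 : (4 : ℝ) * ∑ x ∈ A, ∑ y ∈ Λ, (if y ∉ A then k x y else 0)
        = 2 * (∑ x ∈ Λ, ∑ y ∈ Λ, if x ∈ A ∧ y ∉ A then k x y else 0)
          + 2 * ∑ x ∈ Λ, ∑ y ∈ Λ, if y ∈ A ∧ x ∉ A then k x y else 0 := by
      rw [← e2, e1]; ring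
    rw [e3]
    simp only [← Finset.sum_sub_distrib, Finset.mul_sum, ← Finset.sum_add_distrib]
    refine Finset.sum_congr rfl fun x _ => Finset.sum_congr rfl fun y _ => ?_
    rw [hflip, hflip]
    simp only [k]
    by_cases hx : x ∈ A <;> by_cases hy : y ∈ A <;> simp [hx, hy] <;> ring
  -- pairs across the boundary of the volume
  have h2 : ∑ x ∈ Λ, ∑' y : {y : Site d // y ∉ Λ}, coupling J α x y * spin (σ x) * spin (ω y)
      - ∑ x ∈ Λ, ∑' y : {y : Site d // y ∉ Λ}, coupling J α x y * spin (flip A σ x) * spin (ω y)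
      = 2 * ∑ x ∈ A, ∑' y : {y : Site d // y ∉ Λ}, if (y : Site d) ∉ A then k x y else 0 := by
    rw [← Finset.sum_sub_distrib, ← Finset.sum_subset hA, Finset.mul_sum]
    · refine Finset.sum_congr rfl fun x hx => ?_
      rw [hflip, if_pos hx, two_mul, sub_eq_add_neg, ← tsum_neg]
      congr 1
      · refine tsum_congr fun y => ?_
        rw [if_pos fun hyA => y.2 (hA hyA)]
        simp only [k]
        rw [hσ y y.2]
      · refine tsum_congr fun y => ?_
        rw [if_pos fun hyA => y.2 (hA hyA)]
        simp only [k]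
        rw [hσ y y.2]
        ring
    · intro x _ hx
      rw [hflip, if_neg hx, sub_self]
  have h3 : ∑ x ∈ Λ, h x * spin (σ x) - ∑ x ∈ Λ, h x * spin (flip A σ x)
      = 2 * ∑ x ∈ A, h x * spin (σ x) := by
    rw [← Finset.sum_sub_distrib, ← Finset.sum_subset hA, Finset.mul_sum]
    · refine Finset.sum_congr rfl fun x hx => ?_
      rw [hflip, if_pos hx]
      ring
    · intro x _ hx
      rw [hflip, if_neg hx, sub_self]
  -- A product of two spins is twice the indicator of agreement minus 1.
  have h4 : ∑ x ∈ A, ∑ y ∈ Λ, (if y ∉ A then k x y else 0) +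
      ∑ x ∈ A, ∑' y : {y : Site d // y ∉ Λ}, (if (y : Site d) ∉ A then k x y else 0)
      = 2 * realPairSum J α A (fun x y => x ∈ A ∧ y ∉ A ∧ σ x = σ y)
        - realPairSum J α A (fun x y => x ∈ A ∧ y ∉ A) := by
    unfold realPairSum
    rw [← Finset.sum_add_distrib, Finset.mul_sum, ← Finset.sum_sub_distrib]
    refine Finset.sum_congr rfl fun x hx => ?_
    rw [(hks x).sum_add_tsum_subtype_compl Λ, ← tsum_mul_left, ← Summable.tsum_sub]
    · refine tsum_congr fun y => ?_
      simp only [k]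
      rw [mul_assoc, spin_mul_spin]
      by_cases hy : y ∈ A <;> by_cases hxy : σ x = σ y <;> simp [hx, hy, hxy]
      ring
    · refine Summable.mul_left _ (Summable.of_nonneg_of_le (fun y => ?_) (fun y => ?_) (hs x))
      · split_ifs <;> first | exact coupling_nonneg hJ x y | rfl
      · split_ifs <;> first | exact coupling_nonneg hJ x y | rfl
    · refine Summable.of_nonneg_of_le (fun y => ?_) (fun y => ?_) (hs x)
      · split_ifs <;> first | exact coupling_nonneg hJ x y | rfl
      · split_ifs <;> first | exact coupling_nonneg hJ x y | rfl
  unfold hamiltonian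
  linear_combination (-1 / 2) * h1 - h2 - h3 - 2 * h4

/-- Reversing the spins inside a contour whose interaction with the other contours and with the
field is small lowers the energy by a multiple of its length. -/
theorem energy_gain {d : ℕ} (hd : 0 < d) {J α : ℝ} (hJ : 0 < J) (hα : (d : ℝ) < α)
    (h : Site d → ℝ) {Λ A : Finset (Site d)} (hA : A ⊆ Λ) {ω σ : Config d}
    (hσ : ∀ x ∉ Λ, σ x = ω x)
    (hcross : 8 * pairSum J α (fun x y => x ∈ A ∧ y ∉ A ∧ σ x = σ y) ≤
      pairSum J α fun x y => x ∈ A ∧ y ∉ A)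
    (hfield : ENNReal.ofReal (4 * ∑ x ∈ A, |h x|) ≤ pairSum J α fun x y => x ∈ A ∧ y ∉ A) :
    J * (bdry A).card ≤ hamiltonian J α h Λ ω σ - hamiltonian J α h Λ ω (flip A σ) := by
  classical
  rw [hamiltonian_sub_flip hd hJ.le hα h hA hσ]
  have h0 := card_bdry_le_pairSum (J := J) α A
  rw [pairSum_eq_ofReal hd hJ.le hα A _ fun x y h => h.1] at hcross hfield h0
  rw [pairSum_eq_ofReal hd hJ.le hα A _ fun x y h => h.1] at hcross
  have hnn := realPairSum_nonneg hJ.le α A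
  have e8 : (8 : ℝ≥0∞) = ENNReal.ofReal 8 := by norm_num
  rw [e8, ← ENNReal.ofReal_mul (by norm_num), ENNReal.ofReal_le_ofReal_iff (hnn _)] at hcross
  rw [ENNReal.ofReal_le_ofReal_iff (hnn _)] at hfield
  rw [← ENNReal.ofReal_natCast, ← ENNReal.ofReal_mul hJ.le,
    ENNReal.ofReal_le_ofReal_iff (hnn _)] at h0
  have h5 : ∑ x ∈ A, h x * spin (σ x) ≤ ∑ x ∈ A, |h x| := by
    refine Finset.sum_le_sum fun x _ => (le_abs_self _).trans ?_
    rw [abs_mul, abs_spin, mul_one]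
  -- The balance is `2 - 4 / 8 - 2 / 4 = 1` times the interaction of `A` with its complement, hence
  -- at least `J` times the perimeter.
  linarith

theorem isClopen_spin_ne {d : ℕ} (x : Site d) (b : ℤˣ) : IsClopen {σ : Config d | σ x ≠ b} :=
  (isClopen_discrete {s : ℤˣ | s ≠ b}).preimage (continuous_apply x)

/-! ### The Peierls estimate -/

/-- The Peierls argument in finite volume: if every configuration with `σ x₀ ≠ ω x₀` gains the
energy `G A` by reversing the spins in some `A ∈ S`, then such configurations are improbable. -/
theorem finiteVolumeMeasure_le {d : ℕ} {J α : ℝ} (h : Site d → ℝ) {β : ℝ} (hβ : 0 ≤ β)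
    (Λ : Finset (Site d)) (ω : Config d) (x₀ : Site d) (S : Finset (Finset (Site d)))
    (hS : ∀ A ∈ S, A ⊆ Λ) (G : Finset (Site d) → ℝ)
    (hG : ∀ τ : Λ → ℤˣ, glue Λ ω τ x₀ ≠ ω x₀ → ∃ A ∈ S, G A ≤
      hamiltonian J α h Λ ω (glue Λ ω τ) - hamiltonian J α h Λ ω (flip A (glue Λ ω τ))) :
    finiteVolumeMeasure J α h β Λ ω {σ | σ x₀ ≠ ω x₀} ≤
      ENNReal.ofReal (∑ A ∈ S, Real.exp (-β * G A)) := by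
  classical
  set Z := partitionFunction J α h β Λ ω with hZ
  have hZ0 : 0 < Z := partitionFunction_pos J α h β Λ ω
  have hmeas : MeasurableSet {σ : Config d | σ x₀ ≠ ω x₀} :=
    (isClopen_spin_ne x₀ (ω x₀)).isOpen.measurableSet
  have hw0 : ∀ τ, 0 < weight J α h β Λ ω τ := fun τ => Real.exp_pos _
  have h1 : finiteVolumeMeasure J α h β Λ ω {σ | σ x₀ ≠ ω x₀} =
      ENNReal.ofReal ((∑ τ : Λ → ℤˣ, if glue Λ ω τ x₀ ≠ ω x₀ then weight J α h β Λ ω τ else 0) / Z) := by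
    simp only [finiteVolumeMeasure, Measure.finsetSum_apply, Measure.smul_apply, smul_eq_mul]
    rw [Finset.sum_div, ENNReal.ofReal_sum_of_nonneg]
    · refine Finset.sum_congr rfl fun τ _ => ?_
      rw [Measure.dirac_apply' _ hmeas]
      by_cases hτ : glue Λ ω τ x₀ ≠ ω x₀
      · simp [hτ, hZ]
      · simp [hτ]
    · intro τ _
      split_ifs
      · exact div_nonneg (hw0 τ).le hZ0.le
      · simp
  rw [h1]
  refine ENNReal.ofReal_le_ofReal ?_
  rw [div_le_iff₀ hZ0]
  let fl : Finset (Site d) → (Λ → ℤˣ) → Λ → ℤˣ := fun A τ x => if (x : Site d) ∈ A then -τ x else τ x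
  have hfl : ∀ A ⊆ Λ, ∀ τ, glue Λ ω (fl A τ) = flip A (glue Λ ω τ) := by
    intro A hA τ
    funext x
    unfold glue flip
    by_cases hx : x ∈ Λ
    · simp [hx, fl]
    · have : x ∉ A := fun h => hx (hA h)
      simp [hx, this]
  have hinv : ∀ A, Function.Involutive (fl A) := by
    intro A τ
    funext x
    simp only [fl]
    split_ifs <;> simp
  -- A union bound over `S`. For fixed `A`, reversal is a bijection of the configurations, so the
  -- weights after reversal sum to `Z` exactly.
  calc ∑ τ : Λ → ℤˣ, (if glue Λ ω τ x₀ ≠ ω x₀ then weight J α h β Λ ω τ else 0)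
      ≤ ∑ τ : Λ → ℤˣ, ∑ A ∈ S, Real.exp (-β * G A) * weight J α h β Λ ω (fl A τ) := by
        refine Finset.sum_le_sum fun τ _ => ?_
        have hnn : ∀ A ∈ S, 0 ≤ Real.exp (-β * G A) * weight J α h β Λ ω (fl A τ) :=
          fun A _ => mul_nonneg (Real.exp_pos _).le (hw0 _).le
        split_ifs with hτ
        · obtain ⟨A, hA, hGA⟩ := hG τ hτ
          refine le_trans ?_ (Finset.single_le_sum hnn hA)
          unfold weight
          rw [hfl A (hS A hA), ← Real.exp_add]
          refine Real.exp_le_exp.2 ?_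
          nlinarith
        · exact Finset.sum_nonneg hnn
    _ = ∑ A ∈ S, Real.exp (-β * G A) * Z := by
        rw [Finset.sum_comm]
        refine Finset.sum_congr rfl fun A _ => ?_
        rw [← Finset.mul_sum]
        congr 1
        exact Equiv.sum_comp (hinv A).toPerm fun τ => weight J α h β Λ ω τ
    _ = _ := (Finset.sum_mul _ _ _).symm

/-- Sets that contain `x₀` and have a walkable boundary are counted by walks from `x₀`. -/
theorem sum_pow_card_bdry_le {d : ℕ} (hd : 2 ≤ d) {η ρ : ℝ} {c : ℕ → ℝ} (hη0 : 0 < η) (hη1 : η ≤ 1)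
    (hη : ∀ F : Finset (Edge d), ∑ s ∈ F, stepWeight η s ≤ 1 / 2) (hρ0 : 0 < ρ)
    (hρ : ∀ n, 1 ≤ n → ρ ^ n ≤ c n) (x₀ : Site d) (S : Finset (Finset (Site d)))
    (hS : ∀ A ∈ S, x₀ ∈ A ∧ Walkable η (c (bdry A).card) (bdry A)) {q : ℝ} (hq0 : 0 ≤ q)
    (hq : q ≤ 1 / 8 * (η / 8 ^ (d + 1)) * ρ) :
    ∑ A ∈ S, q ^ (bdry A).card ≤ 1 / 4 := by
  classical
  -- The direction of `p₀` is a dummy, as a step forgets it. The walk of each contour is prefixed by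
  -- one step from `x₀` to a boundary edge within `n ^ 2`, whose weight is at least `(η / 8 ^ (d +
  -- 1)) ^ n` because `1 + n ^ 2 ≤ 8 ^ n`.
  let p₀ : Edge d := (x₀, ⟨0, by omega⟩)
  have hex : ∀ A ∈ S, ∃ l : List (Edge d), (∃ s l', l = s :: l' ∧ visit (next p₀ s) l' = bdry A) ∧
      (η / 8 ^ (d + 1)) ^ (bdry A).card * ρ ^ (bdry A).card ≤ walkWeight η l ∧
      1 ≤ (bdry A).card := by
    intro A hA
    obtain ⟨hx, hW⟩ := hS A hA
    obtain ⟨e, he, hnear⟩ := exists_mem_bdry_near hd hx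
    obtain ⟨l, hl1, -, hl3⟩ := hW e he
    set n := (bdry A).card with hn
    have hn1 : 1 ≤ n := Finset.card_pos.2 ⟨e, he⟩
    refine ⟨(e.1 - x₀, e.2) :: l, ⟨_, _, rfl, ?_⟩, ?_, hn1⟩
    · rw [show next p₀ (e.1 - x₀, e.2) = e by simp [next, p₀]]
      exact hl1
    · rw [walkWeight_cons]
      have hstep : (η / 8 ^ (d + 1)) ^ n ≤ stepWeight η (e.1 - x₀, e.2) := by
        unfold stepWeight
        rw [div_pow, ← pow_mul, mul_comm (d + 1), pow_mul]
        have h1 : η ^ n ≤ η := pow_le_of_le_one hη0.le hη1 (by omega)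
        have h2 : 1 + (nrm (e.1 - x₀) : ℝ) ≤ 8 ^ n := by
          have h3 : 1 + n ^ 2 ≤ 8 ^ n := by
            have h4 : n < 2 ^ n := Nat.lt_two_pow_self
            have h5 : n ^ 2 ≤ (2 ^ n) ^ 2 := Nat.pow_le_pow_left h4.le 2
            have h6 : (8 : ℕ) ^ n = (2 ^ n) ^ 2 * 2 ^ n := by
              rw [← pow_succ, ← pow_mul, mul_comm n, pow_mul]
              norm_num
            have h7 : 1 ≤ (2 ^ n) ^ 2 := Nat.one_le_pow _ _ (by positivity)
            have h8 : 2 ≤ 2 ^ n := by omega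
            rw [h6]
            nlinarith
          have h9 : 1 + nrm (e.1 - x₀) ≤ 8 ^ n := by omega
          exact_mod_cast h9
        gcongr
      exact mul_le_mul hstep ((hρ n hn1).trans hl3) (by positivity) (stepWeight_pos hη0 _).le
  choose! f hf1 hf2 hf3 using hex
  have hinj : Set.InjOn f S := by
    intro A hA B hB hAB
    obtain ⟨s, l, h1, h2⟩ := hf1 A hA
    obtain ⟨t, l', h3, h4⟩ := hf1 B hB
    rw [hAB, h3] at h1
    obtain ⟨rfl, rfl⟩ := List.cons.inj h1
    exact bdry_injective ⟨0, by omega⟩ (h2.symm.trans h4)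
  calc ∑ A ∈ S, q ^ (bdry A).card ≤ ∑ A ∈ S, 1 / 8 * walkWeight η (f A) := by
        refine Finset.sum_le_sum fun A hA => ?_
        calc q ^ (bdry A).card ≤ (1 / 8 * (η / 8 ^ (d + 1)) * ρ) ^ (bdry A).card := by gcongr
          _ = (1 / 8) ^ (bdry A).card *
              ((η / 8 ^ (d + 1)) ^ (bdry A).card * ρ ^ (bdry A).card) := by
            rw [mul_pow, mul_pow, mul_assoc]
          _ ≤ 1 / 8 * walkWeight η (f A) := by
            have h1 : (1 / 8 : ℝ) ^ (bdry A).card ≤ 1 / 8 :=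
              pow_le_of_le_one (by norm_num) (by norm_num) (by have := hf3 A hA; omega)
            exact mul_le_mul h1 (hf2 A hA) (by positivity) (by norm_num)
    _ = 1 / 8 * ∑ l ∈ S.image f, walkWeight η l := by
        rw [← Finset.mul_sum, Finset.sum_image hinj]
    _ ≤ 1 / 8 * 2 := by gcongr; exact sum_walkWeight_le hη0 hη _
    _ = 1 / 4 := by norm_num

/-- The cube `[-n, n]^d`. -/
noncomputable def cube (d n : ℕ) : Finset (Site d) := Finset.Icc (fun _ => -(n : ℤ)) (fun _ => (n : ℤ))

theorem mem_cube {d n : ℕ} {x : Site d} : x ∈ cube d n ↔ ∀ i, |x i| ≤ n := by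
  unfold cube
  rw [Finset.mem_Icc, Pi.le_def, Pi.le_def]
  exact ⟨fun h i => abs_le.2 ⟨h.1 i, h.2 i⟩,
    fun h => ⟨fun i => (abs_le.1 (h i)).1, fun i => (abs_le.1 (h i)).2⟩⟩

theorem invades_cube (d : ℕ) : Invades (cube d) := by
  intro Δ
  refine ⟨Δ.sup nrm, fun n hn x hx => mem_cube.2 fun i => ?_⟩
  have h1 : nrm x ≤ Δ.sup nrm := Finset.le_sup (f := nrm) hx
  have h2 : (x i).natAbs ≤ nrm x :=
    Finset.single_le_sum (f := fun i => (x i).natAbs) (fun _ _ => Nat.zero_le _)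
      (Finset.mem_univ i)
  rw [Int.abs_eq_natAbs]
  omega

/-- A finite set whose boundary lies in the boundary of a subset of a cube lies in that cube. -/
theorem subset_cube_of_bdry_subset {d n : ℕ} (hd : 2 ≤ d) {A P : Finset (Site d)}
    (hP : P ⊆ cube d n) (hAP : bdry A ⊆ bdry P) : A ⊆ cube d n := by
  intro x hx
  rw [mem_cube]
  intro i
  obtain ⟨j, hj⟩ : ∃ j : Fin d, i ≠ j := by
    have : Nontrivial (Fin d) := Fin.nontrivial_iff_two_le.2 hd
    obtain ⟨j, hj⟩ := exists_ne i
    exact ⟨j, hj.symm⟩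
  -- Leaving `A` in a direction `j ≠ i` keeps the `i`-th coordinate, and the exit edge, being in
  -- `bdry P`, has an end in the cube.
  obtain ⟨k, -, h1, h2⟩ := exists_exit hx j
  rw [add_smul, one_smul, ← add_assoc] at h2
  have h3 : (x + (k : ℤ) • unit j, j) ∈ bdry A := mem_bdry.2 (by simp only; tauto)
  have h4 := mem_bdry.1 (hAP h3)
  simp only at h4
  have h5 : x + (k : ℤ) • unit j ∈ P ∨ x + (k : ℤ) • unit j + unit j ∈ P := by tauto
  rcases h5 with h | h
  · simpa [unit_ne hj] using mem_cube.1 (hP h) i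
  · simpa [unit_ne hj] using mem_cube.1 (hP h) i

theorem exists_far_site {d : ℕ} (hd : 0 < d) (F : Finset (Site d)) (L : ℝ) :
    ∃ x : Site d, ∀ z ∈ F, L < nrm (x - z) := by
  obtain ⟨m, hm⟩ := exists_nat_gt L
  refine ⟨((m + F.sup nrm : ℕ) : ℤ) • unit ⟨0, hd⟩, fun z hz => hm.trans_le ?_⟩
  have h1 : nrm z ≤ F.sup nrm := Finset.le_sup (f := nrm) hz
  have h2 := nrm_sub_le (((m + F.sup nrm : ℕ) : ℤ) • unit ⟨0, hd⟩) z 0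
  rw [sub_zero, sub_zero, nrm_smul_unit, Int.natAbs_natCast] at h2
  exact Nat.cast_le.2 (by omega)

theorem units_ne_iff (a b c : ℤˣ) : (a ≠ c ↔ b ≠ c) ↔ a = b := by
  rcases Int.units_eq_one_or a with rfl | rfl <;> rcases Int.units_eq_one_or b with rfl | rfl <;>
    rcases Int.units_eq_one_or c with rfl | rfl <;> decide

/-- The Peierls bound: at low temperature, if the field is bounded by a small multiple of
`|x|^{-s}` off a finite set, then some spin remembers constant boundary conditions. -/
theorem exists_peierls_bound {d : ℕ} (hd : 2 ≤ d) {J α s : ℝ} (hJ : 0 < J) (hα : (d : ℝ) < α)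
    (hs : (α < d + 1 ∧ s = α - d) ∨ s = 1) :
    ∃ βc : ℝ, 0 < βc ∧ ∃ h₀ : ℝ, 0 < h₀ ∧ ∀ β, βc < β → ∀ (h : Site d → ℝ) (F : Finset (Site d)),
      (∀ x ∉ F, |h x| ≤ h₀ * decay s x) → ∃ x₀ : Site d, ∀ (b : ℤˣ) (n : ℕ),
        finiteVolumeMeasure J α h β (cube d n) (fun _ => b) {σ | σ x₀ ≠ b} ≤
          ENNReal.ofReal (1 / 4) := by
  classical
  have hd0 : 0 < d := by omega
  obtain ⟨R, a, hR, hcross⟩ := exists_cross_le hd hJ hα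
  obtain ⟨K, hK0, hK⟩ := exists_sum_decay_le hd hJ hα hs
  obtain ⟨η, hη0, hη1, hη⟩ := exists_stepWeight hd0
  obtain ⟨c, ρ, hρ0, hρ1, hρ, hc1, hc⟩ := exists_clusterWeight hη0 hη1 d R a
  have hc0 : ∀ n, 1 ≤ n → 0 < c n := fun n hn => (pow_pos hρ0 n).trans_le (hρ n hn)
  set q : ℝ := 1 / 8 * (η / 8 ^ (d + 1)) * ρ with hq
  have hq0 : 0 < q := by positivity
  have hq1 : q < 1 := by
    have h8 : (1 : ℝ) ≤ 8 ^ (d + 1) := one_le_pow₀ (by norm_num)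
    have : η / 8 ^ (d + 1) ≤ 1 := by
      rw [div_le_one (by positivity)]; linarith
    have : η / 8 ^ (d + 1) * ρ ≤ 1 := mul_le_one₀ this hρ0.le hρ1
    rw [hq, mul_assoc]
    linarith
  refine ⟨-Real.log q / J, div_pos (neg_pos.2 (Real.log_neg hq0 hq1)) hJ, 1 / (8 * K),
    by positivity, ?_⟩
  intro β hβ h F hF
  have hβ0 : 0 < β := (div_pos (neg_pos.2 (Real.log_neg hq0 hq1)) hJ).trans hβ
  have hβq : Real.exp (-β * J) ≤ q := by
    rw [div_lt_iff₀ hJ] at hβ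
    rw [← Real.le_log_iff_exp_le hq0]
    linarith
  set H := ∑ x ∈ F, |h x| with hH
  have hH0 : 0 ≤ H := Finset.sum_nonneg fun _ _ => abs_nonneg _
  -- A contour of length at least `n₀` pays for the whole field on `F`. The site `x₀` is so far from
  -- `F` that every shorter contour around it encloses no site of `F`: two detours of length at most
  -- `n₀ ^ 2` and a diameter of at most `(ρ ^ n₀)⁻¹` do not bridge the distance.
  obtain ⟨n₀, hn₀⟩ := exists_nat_ge (8 * H / J)
  rw [div_le_iff₀ hJ] at hn₀
  obtain ⟨x₀, hx₀⟩ := exists_far_site hd0 F (2 * (n₀ : ℝ) ^ 2 + (ρ ^ n₀)⁻¹)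
  refine ⟨x₀, fun b n => ?_⟩
  set Λ := cube d n with hΛ
  let S : Finset (Finset (Site d)) := Λ.powerset.filter fun A =>
    x₀ ∈ A ∧ (bdry A).Nonempty ∧ Walkable η (c (bdry A).card) (bdry A)
  have hS : ∀ A ∈ S, A ⊆ Λ ∧ x₀ ∈ A ∧ (bdry A).Nonempty ∧
      Walkable η (c (bdry A).card) (bdry A) := by
    intro A hA
    rw [Finset.mem_filter, Finset.mem_powerset] at hA
    exact hA
  -- the field is dominated by the interaction
  have hfield : ∀ A ∈ S, ENNReal.ofReal (4 * ∑ x ∈ A, |h x|) ≤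
      pairSum J α fun x y => x ∈ A ∧ y ∉ A := by
    intro A hA
    obtain ⟨-, hxA, hne, hW⟩ := hS A hA
    set m := (bdry A).card with hm
    have hm1 : 1 ≤ m := hne.card_pos
    set cut := pairSum J α fun x y => x ∈ A ∧ y ∉ A with hcut
    have h1 : ∑ x ∈ A, |h x| ≤ 1 / (8 * K) * ∑ x ∈ A, decay s x + ∑ x ∈ A.filter (· ∈ F), |h x| := by
      rw [← Finset.sum_filter_add_sum_filter_not A (fun x => x ∈ F), add_comm]
      gcongr
      calc _ ≤ ∑ x ∈ A.filter (fun x => x ∉ F), 1 / (8 * K) * decay s x :=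
            Finset.sum_le_sum fun x hx => hF x (Finset.mem_filter.1 hx).2
        _ ≤ ∑ x ∈ A, 1 / (8 * K) * decay s x :=
            Finset.sum_le_sum_of_subset_of_nonneg (Finset.filter_subset _ _)
              fun x _ _ => mul_nonneg (by positivity) (decay_nonneg s x)
        _ = _ := (Finset.mul_sum _ _ _).symm
    have h2 : ∑ x ∈ A.filter (· ∈ F), |h x| ≤ J * m / 8 := by
      rcases (A.filter (· ∈ F)).eq_empty_or_nonempty with he | ⟨z, hz⟩
      · rw [he, Finset.sum_empty]
        positivity
      · rw [Finset.mem_filter] at hz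
        have h3 : ∑ x ∈ A.filter (· ∈ F), |h x| ≤ H :=
          Finset.sum_le_sum_of_subset_of_nonneg (fun x hx => (Finset.mem_filter.1 hx).2)
            fun _ _ _ => abs_nonneg _
        have h4 : n₀ ≤ m := by
          by_contra hlt
          rw [not_le] at hlt
          obtain ⟨e, he, he2⟩ := exists_mem_bdry_near hd hxA
          obtain ⟨f, hf, hf2⟩ := exists_mem_bdry_near hd hz.1
          have h5 := hW.edist_le hη0 hη1 (hc0 m hm1) he hf
          have h6 : nrm (x₀ - z) ≤ m ^ 2 + edist e f + m ^ 2 := by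
            have t1 := nrm_sub_le x₀ e.1 z
            have t2 := nrm_sub_le e.1 f.1 z
            rw [nrm_sub_comm x₀ e.1] at t1
            change _ ≤ edist e f + _ at t2
            rw [← hm] at he2 hf2
            omega
          have h7 : (nrm (x₀ - z) : ℝ) ≤ (m : ℝ) ^ 2 + edist e f + (m : ℝ) ^ 2 := by
            exact_mod_cast h6
          have h8 : (c m)⁻¹ ≤ (ρ ^ n₀)⁻¹ := by
            refine inv_anti₀ (by positivity) (le_trans ?_ (hρ m hm1))
            exact pow_le_pow_of_le_one hρ0.le hρ1 hlt.le
          have h9 : (m : ℝ) ^ 2 ≤ (n₀ : ℝ) ^ 2 := by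
            have : (m : ℝ) ≤ n₀ := by exact_mod_cast hlt.le
            gcongr
          have := hx₀ z hz.2
          linarith
        have h5 : (n₀ : ℝ) ≤ m := by exact_mod_cast h4
        nlinarith
    have h3 : ENNReal.ofReal (1 / (2 * K) * ∑ x ∈ A, decay s x) ≤ ENNReal.ofReal (1 / 2) * cut := by
      rw [ENNReal.ofReal_mul (by positivity)]
      calc _ ≤ ENNReal.ofReal (1 / (2 * K)) * (ENNReal.ofReal K * cut) := by gcongr; exact hK A
        _ = ENNReal.ofReal (1 / 2) * cut := by
          rw [← mul_assoc, ← ENNReal.ofReal_mul (by positivity)]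
          congr 2
          field_simp
    have h4 : ENNReal.ofReal (1 / 2 * (J * m)) ≤ ENNReal.ofReal (1 / 2) * cut := by
      rw [ENNReal.ofReal_mul (by norm_num), ENNReal.ofReal_mul hJ.le, ENNReal.ofReal_natCast]
      gcongr
      exact card_bdry_le_pairSum α A
    calc ENNReal.ofReal (4 * ∑ x ∈ A, |h x|)
        ≤ ENNReal.ofReal (1 / (2 * K) * ∑ x ∈ A, decay s x + 1 / 2 * (J * m)) := by
          refine ENNReal.ofReal_le_ofReal ?_
          have e : 1 / (2 * K) = 4 * (1 / (8 * K)) := by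
            field_simp
            norm_num
          rw [e]
          linarith
      _ ≤ _ := ENNReal.ofReal_add_le
      _ ≤ ENNReal.ofReal (1 / 2) * cut + ENNReal.ofReal (1 / 2) * cut := add_le_add h3 h4
      _ = cut := by
          rw [← add_mul, ← ENNReal.ofReal_add (by norm_num) (by norm_num)]
          norm_num
  refine (finiteVolumeMeasure_le h hβ0.le Λ (fun _ => b) x₀ S (fun A hA => (hS A hA).1)
    (fun A => J * (bdry A).card) ?_).trans ?_
  · intro τ hτ
    set σ := glue Λ (fun _ => b) τ with hσ
    have hσΛ : ∀ x ∉ Λ, σ x = b := fun x hx => by simp [hσ, glue, hx]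
    let P := Λ.filter fun x => σ x ≠ b
    have hP : ∀ x, x ∈ P ↔ σ x ≠ b := by
      intro x
      rw [Finset.mem_filter, and_iff_right_iff_imp]
      intro hx
      by_contra hxΛ
      exact hx (hσΛ x hxΛ)
    obtain ⟨Γ, hΓ⟩ := exists_isContourFamily hd hη0 hR (fun n hn => (hc0 n hn).le) hc1 hc P
    obtain ⟨A, hA, hxA⟩ := hΓ.exists_mem ((hP x₀).2 hτ)
    have hAΛ : A ⊆ Λ := subset_cube_of_bdry_subset hd (Finset.filter_subset _ _) (hΓ.subset A hA)
    have hAS : A ∈ S := Finset.mem_filter.2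
      ⟨Finset.mem_powerset.2 hAΛ, hxA, hΓ.nonempty A hA, hΓ.walkable A hA⟩
    refine ⟨A, hAS, energy_gain hd0 hJ hα h hAΛ hσΛ ?_ (hfield A hAS)⟩
    have := hcross η c P Γ hΓ A hA
    simpa only [hP, units_ne_iff] using this
  · refine ENNReal.ofReal_le_ofReal (le_trans (Finset.sum_le_sum fun A _ => ?_)
      (sum_pow_card_bdry_le hd hη0 hη1 hη hρ0 hρ x₀ S
        (fun A hA => ⟨(hS A hA).2.1, (hS A hA).2.2.2⟩) hq0.le le_rfl))
    rw [← mul_assoc, mul_comm, Real.exp_nat_mul]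
    gcongr

/-! ### Two different Gibbs measures -/

theorem subset_gibbsMeasures {d : ℕ} (J α : ℝ) (h : Site d → ℝ) (β : ℝ) :
    thermodynamicLimits J α h β ⊆ gibbsMeasures J α h β :=
  fun _ hμ => subset_closure (subset_convexHull ℝ≥0 _ (Set.mem_image_of_mem _ hμ))

/-- If a spin disagrees with constant boundary conditions with probability at most `1 / 4`,
uniformly in the volume, then there is a thermodynamic limit with that property. -/
theorem exists_thermodynamicLimit {d : ℕ} {J α : ℝ} {h : Site d → ℝ} {β : ℝ} {x₀ : Site d} (b : ℤˣ)
    (hb : ∀ n, finiteVolumeMeasure J α h β (cube d n) (fun _ => b) {σ | σ x₀ ≠ b} ≤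
      ENNReal.ofReal (1 / 4)) :
    ∃ μ ∈ thermodynamicLimits J α h β, (μ : Measure (Config d)) {σ | σ x₀ ≠ b} ≤
      ENNReal.ofReal (1 / 4) := by
  obtain ⟨μ, φ, hφ, hlim⟩ := CompactSpace.tendsto_subseq
    fun n => finiteVolumeGibbs J α h β (cube d n) fun _ => b
  refine ⟨μ, ⟨fun _ => b, fun n => cube d (φ n), ?_, hlim⟩, ?_⟩
  · intro Δ
    obtain ⟨N, hN⟩ := invades_cube d Δ
    exact ⟨N, fun n hn => hN _ (hn.trans (hφ.id_le n))⟩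
  -- The event depends on one spin and is open, so its limit probability is at most the lower limit.
  · have h1 := ProbabilityMeasure.le_liminf_measure_open_of_tendsto hlim (isClopen_spin_ne x₀ b).isOpen
    refine h1.trans ?_
    refine liminf_le_of_le (by isBoundedDefault) fun c hc => ?_
    obtain ⟨n, hn⟩ := hc.exists
    exact hn.trans (hb (φ n))

/-- If the limits for the two boundary conditions coincided, the events `σ x₀ ≠ 1` and `σ x₀ ≠ -1`,
which cover the space, would have total probability at most 1/2. -/
theorem phaseTransition_of_peierls_bound {d : ℕ} {J α : ℝ} {h : Site d → ℝ} {β : ℝ} {x₀ : Site d}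
    (hb : ∀ (b : ℤˣ) (n : ℕ), finiteVolumeMeasure J α h β (cube d n) (fun _ => b) {σ | σ x₀ ≠ b} ≤
      ENNReal.ofReal (1 / 4)) : PhaseTransition J α h β := by
  obtain ⟨μ, hμ, hμ'⟩ := exists_thermodynamicLimit 1 (hb 1)
  obtain ⟨ν, hν, hν'⟩ := exists_thermodynamicLimit (-1) (hb (-1))
  refine Set.one_lt_encard_iff.2
    ⟨μ, ν, subset_gibbsMeasures J α h β hμ, subset_gibbsMeasures J α h β hν, ?_⟩
  rintro rfl
  have h1 : (μ : Measure (Config d)) Set.univ ≤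
      ENNReal.ofReal (1 / 4) + ENNReal.ofReal (1 / 4) := by
    have hcover : (Set.univ : Set (Config d)) ⊆ {σ | σ x₀ ≠ 1} ∪ {σ | σ x₀ ≠ -1} := by
      intro σ _
      rcases Int.units_eq_one_or (σ x₀) with h | h
      · right; simp [h]
      · left; simp [h]
    exact (measure_mono hcover).trans ((measure_union_le _ _).trans (add_le_add hμ' hν'))
  rw [measure_univ, ← ENNReal.ofReal_add (by norm_num) (by norm_num), ← ENNReal.ofReal_one,
    ENNReal.ofReal_le_ofReal_iff (by norm_num)] at h1
  norm_num at h1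

theorem abs_decayingField {d : ℕ} {hs : ℝ} (hhs : 0 ≤ hs) (δ : ℝ) (x : Site d) :
    |decayingField hs δ x| = hs * decay δ x := by
  unfold decayingField decay
  rw [l1_eq_nrm]
  split_ifs
  · rw [abs_of_nonneg hhs, mul_one]
  · rw [abs_of_nonneg (by positivity), mul_one_div]

/-- The ratio of the two profiles is `|x| ^ (s - δ)`, which tends to 0; this is why the strength of
the field is irrelevant above the critical exponent. -/
theorem exists_field_le {d : ℕ} {hs h₀ δ s : ℝ} (hhs : 0 < hs) (h₀pos : 0 < h₀) (hδ : s < δ) :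
    ∃ F : Finset (Site d), ∀ x ∉ F, |decayingField hs δ x| ≤ h₀ * decay s x := by
  obtain ⟨N, hN⟩ := exists_nat_ge ((hs / h₀) ^ (1 / (δ - s)))
  refine ⟨cube d N, fun x hx => ?_⟩
  rw [mem_cube] at hx
  push Not at hx
  obtain ⟨i, hi⟩ := hx
  have h1 : N < nrm x := by
    have h2 : (x i).natAbs ≤ nrm x :=
      Finset.single_le_sum (f := fun i => (x i).natAbs) (fun _ _ => Nat.zero_le _)
        (Finset.mem_univ i)
    rw [Int.abs_eq_natAbs] at hi
    omega
  have hx0 : x ≠ 0 := by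
    rintro rfl
    simp at h1
  have hnpos : (0 : ℝ) < nrm x := by exact_mod_cast nrm_pos hx0
  have hδs : 0 < δ - s := by linarith
  have h3 : hs / h₀ ≤ (nrm x : ℝ) ^ (δ - s) := by
    calc hs / h₀ = ((hs / h₀) ^ (1 / (δ - s))) ^ (δ - s) := by
          rw [← Real.rpow_mul (by positivity), one_div_mul_cancel hδs.ne', Real.rpow_one]
      _ ≤ _ := by
          gcongr
          exact hN.trans (by exact_mod_cast h1.le)
  rw [abs_decayingField hhs.le]
  unfold decay
  rw [if_neg hx0, if_neg hx0, mul_one_div, mul_one_div,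
    div_le_div_iff₀ (by positivity) (by positivity)]
  rw [div_le_iff₀ h₀pos, Real.rpow_sub hnpos, div_mul_eq_mul_div, le_div_iff₀ (by positivity)] at h3
  linarith

end LongRangeIsing

theorem theorem4p1 (d : ℕ) (hd : 2 ≤ d) (J : ℝ) (hJ : 0 < J) (α : ℝ) (hα : (d : ℝ) < α) :
    ∃ βc : ℝ, 0 < βc ∧ ∃ h₀ : ℝ, 0 < h₀ ∧
      ∀ β : ℝ, βc < β → ∀ δ : ℝ, 0 < δ → ∀ hs : ℝ, 0 < hs →
        ((α < d + 1 ∧ α - d < δ) ∨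
          (α < d + 1 ∧ δ = α - d ∧ hs ≤ h₀) ∨
          ((d : ℝ) + 1 ≤ α ∧ 1 < δ) ∨
          ((d : ℝ) + 1 ≤ α ∧ δ = 1 ∧ hs ≤ h₀)) →
        LongRangeIsing.PhaseTransition J α
          (LongRangeIsing.decayingField hs δ : LongRangeIsing.Site d → ℝ) β := by
  -- The four cases reduce to the critical exponent `s`, which depends on `α` and `d` only: `α - d`
  -- below `d + 1` and `1` from there on. So `βc` and `h₀` are fixed before `δ` and the field
  -- strength.
  obtain ⟨s, hs, hcases⟩ : ∃ s : ℝ, ((α < d + 1 ∧ s = α - d) ∨ s = 1) ∧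
      ∀ δ hs h₀ : ℝ, ((α < d + 1 ∧ α - d < δ) ∨ (α < d + 1 ∧ δ = α - d ∧ hs ≤ h₀) ∨
          ((d : ℝ) + 1 ≤ α ∧ 1 < δ) ∨ ((d : ℝ) + 1 ≤ α ∧ δ = 1 ∧ hs ≤ h₀)) →
        s < δ ∨ (δ = s ∧ hs ≤ h₀) := by
    rcases lt_or_ge α (d + 1) with h | h
    · refine ⟨α - d, Or.inl ⟨h, rfl⟩, ?_⟩
      rintro δ hs h₀ (h1 | h1 | h1 | h1)
      · exact Or.inl h1.2
      · exact Or.inr h1.2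
      · exact absurd h1.1 (not_le.2 h)
      · exact absurd h1.1 (not_le.2 h)
    · refine ⟨1, Or.inr rfl, ?_⟩
      rintro δ hs h₀ (h1 | h1 | h1 | h1)
      · exact absurd h1.1 (not_lt.2 h)
      · exact absurd h1.1 (not_lt.2 h)
      · exact Or.inl h1.2
      · exact Or.inr h1.2
  obtain ⟨βc, hβc, h₀, hh₀, hmain⟩ := LongRangeIsing.exists_peierls_bound hd hJ hα hs
  refine ⟨βc, hβc, h₀, hh₀, fun β hβ δ _ h hh hc => ?_⟩
  obtain ⟨F, hF⟩ : ∃ F : Finset (LongRangeIsing.Site d), ∀ x ∉ F,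
      |LongRangeIsing.decayingField h δ x| ≤ h₀ * LongRangeIsing.decay s x := by
    rcases hcases δ h h₀ hc with h1 | ⟨rfl, h1⟩
    · exact LongRangeIsing.exists_field_le hh hh₀ h1
    · refine ⟨∅, fun x _ => ?_⟩
      rw [LongRangeIsing.abs_decayingField hh.le]
      exact mul_le_mul_of_nonneg_right h1 (LongRangeIsing.decay_nonneg _ x)
  obtain ⟨x₀, hx₀⟩ := hmain β hβ _ F hF
  exact LongRangeIsing.phaseTransition_of_peierls_bound hx₀
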